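/- Let $0<q<1$ and $\alpha\in\mathbb{R}\setminus\{0\}$. Let $B=B(\alpha,q)$ be the self-adjoint operator on the complex Hilbert space $\ell^2(\mathbb{Z})$ with domain $\operatorname{Dom}B=\{\psi\in\ell^2(\mathbb{Z}) : (q^{-n}\psi_n)_{n\in\mathbb{Z}}\in\ell^2(\mathbb{Z})\}$ acting by $$(B\psi)_n=\psi_{n-1}+\alpha q^{-n}\psi_n+\psi_{n+1},\qquad n\in\mathbb{Z}.$$ Write $(a;q)_k=\prod_{i=0}^{k-1}(1-aq^i)$ and $(a;q)_\infty=\prod_{i=0}^{\infty}(1-aq^i)$, and let $${}_1\tilde\phi_1(a;b;q,z)=\sum_{k=0}^{\infty}\frac{(a;q)_k\,(bq^k;q)_\infty}{(q;q)_k}(-1)^kq^{k(k-1)/2}z^k$$ be the regularized confluent basic hypergeometric series, which equals $(b;q)_\infty\,{}_1\phi_1(a;b;q,z)$ whenever $b\notin\{q^{-i} : i=0,1,2,\dots\}$. Then $$\operatorname{spec}(B)\setminus[-2,2]=\operatorname{spec}_p(B)=\left\{\alpha^{-1}q^m+\alpha q^{-m} : m\in\mathbb{Z},\ m>\lfloor\log_q|\alpha|\rfloor\right\},$$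 where $\operatorname{spec}_p(B)$ is the set of eigenvalues of $B$, and every point of this set is a simple eigenvalue of $B$, i.e. $\dim\operatorname{Ker}(B-x)=1$. Moreover, for each integer $m>\lfloor\log_q|\alpha|\rfloor$, the sequence $\mathbf{v}_m=(v_{m,j})_{j\in\mathbb{Z}}$ with $$v_{m,j}=(-1)^j\alpha^{-j}q^{j(j+1)/2}\,{}_1\tilde\phi_1\!\left(0;q^{-m+j+1};q,\alpha^{-2}q^{m+j+1}\right)$$ is a (nonzero, square-summable) eigenvector of $B$ corresponding to the eigenvalue $\alpha^{-1}q^m+\alpha q^{-m}$. -/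

import Mathlib

noncomputable section

/-- The complex Hilbert space `ℓ²(ℤ)`. -/
abbrev EllTwo : Type := lp (fun _ : ℤ => ℂ) 2

section UnboundedOperators

variable {H : Type*} [NormedAddCommGroup H] [InnerProductSpace ℂ H]

/-- `x` belongs to the resolvent set of the (unbounded) operator `T` if `T - x : Dom T → H` has a
bounded everywhere defined two-sided inverse `R`. -/
def InResolventSet (T : H →ₗ.[ℂ] H) (x : ℂ) : Prop :=
  ∃ R : H →L[ℂ] H,
    (∀ φ : H, ∃ h : R φ ∈ T.domain, T ⟨R φ, h⟩ - x • R φ = φ) ∧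
    (∀ ψ : T.domain, R (T ψ - x • (ψ : H)) = ψ)

/-- The spectrum of an unbounded operator: the complement of its resolvent set. -/
def opSpectrum (T : H →ₗ.[ℂ] H) : Set ℂ :=
  {x | ¬ InResolventSet T x}

/-- The eigenspace `Ker (T - x)`, as a subspace of `H`. -/
def opEigenspace (T : H →ₗ.[ℂ] H) (x : ℂ) : Submodule ℂ H :=
  (LinearMap.ker (T.toFun - x • T.domain.subtype)).map T.domain.subtype

/-- The point spectrum: the set of eigenvalues. -/
def pointSpectrum (T : H →ₗ.[ℂ] H) : Set ℂ :=
  {x | opEigenspace T x ≠ ⊥}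

/-- An eigenvalue is simple if its eigenspace is one-dimensional. -/
def IsSimpleEigenvalue (T : H →ₗ.[ℂ] H) (x : ℂ) : Prop :=
  Module.finrank ℂ (opEigenspace T x) = 1

theorem mem_opEigenspace_iff (T : H →ₗ.[ℂ] H) (x : ℂ) (ψ : H) :
    ψ ∈ opEigenspace T x ↔ ∃ h : ψ ∈ T.domain, T ⟨ψ, h⟩ = x • ψ := by
  simp only [opEigenspace, Submodule.mem_map, LinearMap.mem_ker, LinearMap.sub_apply,
    LinearMap.smul_apply, sub_eq_zero]
  constructor
  · rintro ⟨y, hy, rfl⟩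
    exact ⟨y.2, hy⟩
  · rintro ⟨h, hx⟩
    exact ⟨⟨ψ, h⟩, hx, rfl⟩

end UnboundedOperators

section OperatorB

theorem memlp_shift (ψ : EllTwo) (k : ℤ) : Memℓp (fun n : ℤ => ψ (n + k)) 2 := by
  have h := lp.memℓp ψ
  rw [memℓp_gen_iff (by norm_num)] at h ⊢
  exact (Equiv.addRight k).summable_iff.mpr h

/-- The natural domain `{ψ ∈ ℓ²(ℤ) | Vψ ∈ ℓ²(ℤ)}` of the multiplication operator
`(Vψ)ₙ = q⁻ⁿ ψₙ`. -/
def domV (q : ℝ) : Submodule ℂ EllTwo where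
  carrier := {ψ | Memℓp (fun n : ℤ => (q : ℂ) ^ (-n) * ψ n) 2}
  zero_mem' := by
    have h : (fun n : ℤ => (q : ℂ) ^ (-n) * (0 : EllTwo) n) = 0 := by
      funext n; simp
    show Memℓp _ 2
    rw [h]
    exact zero_memℓp
  add_mem' := by
    intro φ ψ hφ hψ
    have h : (fun n : ℤ => (q : ℂ) ^ (-n) * (φ + ψ : EllTwo) n)
        = (fun n : ℤ => (q : ℂ) ^ (-n) * φ n) + (fun n : ℤ => (q : ℂ) ^ (-n) * ψ n) := by
      funext n; simp [mul_add]
    show Memℓp _ 2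
    rw [h]
    exact Memℓp.add hφ hψ
  smul_mem' := by
    intro c ψ hψ
    have h : (fun n : ℤ => (q : ℂ) ^ (-n) * (c • ψ : EllTwo) n)
        = c • (fun n : ℤ => (q : ℂ) ^ (-n) * ψ n) := by
      funext n; simp [mul_left_comm]
    show Memℓp _ 2
    rw [h]
    exact Memℓp.const_smul hψ c

theorem memlp_opB (α q : ℝ) (ψ : domV q) :
    Memℓp (fun n : ℤ => (ψ : EllTwo) (n - 1) + (α : ℂ) * (q : ℂ) ^ (-n) * (ψ : EllTwo) n
      + (ψ : EllTwo) (n + 1)) 2 := by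
  have h1 := memlp_shift (ψ : EllTwo) (-1)
  have h2 := memlp_shift (ψ : EllTwo) 1
  have h3 : Memℓp (fun n : ℤ => (q : ℂ) ^ (-n) * (ψ : EllTwo) n) 2 := ψ.2
  have h := (h1.add (h3.const_smul (α : ℂ))).add h2
  convert h using 1
  funext n
  simp [sub_eq_add_neg, mul_assoc]

/-- The discrete Schrödinger operator `B = U + U* + αV` on `ℓ²(ℤ)`, with domain `Dom V`; thus
`(Bψ)ₙ = ψₙ₋₁ + α q⁻ⁿ ψₙ + ψₙ₊₁`. -/
def opB (α q : ℝ) : EllTwo →ₗ.[ℂ] EllTwo where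
  domain := domV q
  toFun :=
    { toFun := fun ψ => ⟨fun n : ℤ => (ψ : EllTwo) (n - 1)
          + (α : ℂ) * (q : ℂ) ^ (-n) * (ψ : EllTwo) n + (ψ : EllTwo) (n + 1), memlp_opB α q ψ⟩
      map_add' := by
        intro φ ψ
        ext n
        show (φ : EllTwo) (n - 1) + (ψ : EllTwo) (n - 1)
            + (α : ℂ) * (q : ℂ) ^ (-n) * ((φ : EllTwo) n + (ψ : EllTwo) n)
            + ((φ : EllTwo) (n + 1) + (ψ : EllTwo) (n + 1))
          = ((φ : EllTwo) (n - 1) + (α : ℂ) * (q : ℂ) ^ (-n) * (φ : EllTwo) n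
              + (φ : EllTwo) (n + 1))
            + ((ψ : EllTwo) (n - 1) + (α : ℂ) * (q : ℂ) ^ (-n) * (ψ : EllTwo) n
              + (ψ : EllTwo) (n + 1))
        ring
      map_smul' := by
        intro c ψ
        ext n
        simp
        ring }

end OperatorB

section BasicHypergeometric

/-- The finite `q`-shifted factorial `(a; q)ₖ = ∏_{i<k} (1 - a qⁱ)`. -/
def qPoch (a q : ℂ) (k : ℕ) : ℂ :=
  ∏ i ∈ Finset.range k, (1 - a * q ^ i)

/-- The infinite `q`-shifted factorial `(a; q)_∞ = ∏_{i≥0} (1 - a qⁱ)`. -/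
def qPochInf (a q : ℂ) : ℂ :=
  ∏' i : ℕ, (1 - a * q ^ i)

/-- The basic hypergeometric series `₁φ₁(a; b; q, z)`, for `b ∉ {1, q⁻¹, q⁻², …}`. -/
def phiOneOne (a b q z : ℂ) : ℂ :=
  ∑' k : ℕ, qPoch a q k / (qPoch q q k * qPoch b q k) * (-1) ^ k * q ^ (k.choose 2) * z ^ k

/-- The regularized series `₁φ̃₁(a; b; q, z)`, that is `(b; q)_∞ ₁φ₁(a; b; q, z)`
(see `regPhiOneOne_eq`), continued analytically to all `b ∈ ℂ` by means of
`(b; q)_∞ / (b; q)ₖ = (b qᵏ; q)_∞`. -/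
def regPhiOneOne (a b q z : ℂ) : ℂ :=
  ∑' k : ℕ, qPoch a q k * qPochInf (b * q ^ k) q / qPoch q q k
    * (-1) ^ k * q ^ (k.choose 2) * z ^ k

theorem multipliable_qPoch (a q : ℂ) (hq : ‖q‖ < 1) :
    Multipliable (fun i : ℕ => 1 - a * q ^ i) := by
  have h : Summable (fun i : ℕ => -(a * q ^ i)) :=
    ((summable_geometric_of_norm_lt_one hq).mul_left a).neg
  simpa [sub_eq_add_neg] using Complex.multipliable_one_add_of_summable h

theorem qPochInf_eq (b q : ℂ) (hq : ‖q‖ < 1) (k : ℕ) :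
    qPochInf b q = qPoch b q k * qPochInf (b * q ^ k) q := by
  induction k with
  | zero => simp [qPoch]
  | succ k ih =>
    rw [ih, qPoch, qPoch, Finset.prod_range_succ, mul_assoc]
    congr 1
    have h := (multipliable_qPoch (b * q ^ (k + 1)) q hq)
    have h' : (fun i : ℕ => 1 - b * q ^ (k + 1) * q ^ i)
        = fun i : ℕ => 1 - b * q ^ k * q ^ (i + 1) := by
      funext i; ring
    rw [qPochInf, qPochInf, h']
    rw [h'] at h
    have h2 : ∏' i : ℕ, (1 - b * q ^ k * q ^ i)
        = (1 - b * q ^ k * q ^ 0) * ∏' i : ℕ, (1 - b * q ^ k * q ^ (i + 1)) :=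
      tprod_eq_zero_mul' (f := fun i : ℕ => 1 - b * q ^ k * q ^ i) h
    rw [h2, pow_zero, mul_one]

/-- Where `₁φ₁` is defined, the regularized series is `(b; q)_∞ ₁φ₁(a; b; q, z)`. -/
theorem regPhiOneOne_eq (a b q z : ℂ) (hq : ‖q‖ < 1) (hb : ∀ i : ℕ, b * q ^ i ≠ 1) :
    regPhiOneOne a b q z = qPochInf b q * phiOneOne a b q z := by
  rw [regPhiOneOne, phiOneOne, ← tsum_mul_left]
  congr 1
  funext k
  have h0 : qPoch b q k ≠ 0 :=
    Finset.prod_ne_zero_iff.mpr fun i _ => sub_ne_zero.mpr (hb i).symm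
  rw [qPochInf_eq b q hq k, ← div_div]
  field_simp

end BasicHypergeometric

/-- The eigenvalue `α⁻¹ qᵐ + α q⁻ᵐ`. -/
def eigvalB (α q : ℝ) (m : ℤ) : ℂ :=
  (α : ℂ)⁻¹ * (q : ℂ) ^ m + (α : ℂ) * (q : ℂ) ^ (-m)

/-- The components
`v_{m,j} = (-1)ʲ α⁻ʲ q^{j(j+1)/2} ₁φ̃₁(0; q^{-m+j+1}; q, α⁻² q^{m+j+1})`. The integer division
`j (j + 1) / 2` is exact. -/
def eigvecB (α q : ℝ) (m j : ℤ) : ℂ :=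
  (-1) ^ j * (α : ℂ) ^ (-j) * (q : ℂ) ^ (j * (j + 1) / 2)
    * regPhiOneOne 0 ((q : ℂ) ^ (-m + j + 1)) q ((α : ℂ) ^ (-2 : ℤ) * (q : ℂ) ^ (m + j + 1))

end

/-! Every x is w + w⁻¹ with 0 < |w| ≤ 1. For Ψ(z) = Σ ψₙ zⁿ the eigenvalue equation reads (1 - wz)(1
- w/z) Ψ(z) = αw Ψ(z/q). Put H(z) = Ψ(z) / (qwz; q)_∞; the factor 1 - wz then cancels, leaving w
hₙ₊₁ = (1 - αw q⁻ⁿ) hₙ (`IsEigenSeq.qExpConv_succ`). The series are only formal, so division becomes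
the convolution `qExpConv`, and decay of ψ at -∞ justifies the cancellation. Unless αw is a power of
q, the factors never vanish and blow up at +∞, so the bounded sequence h is zero; if |w| = 1, decay
at -∞ kills h as well. Since the convolution is injective, eigenvalues force αw = qᵐ and |w| < 1
(`IsEigenSeq.exists_zpow`).

Conversely, for w = α⁻¹qᵐ with |w| < 1, the function F(z) = (qw/z; q)_∞ / (wz; q)_∞ satisfies F(qz)
= (1 - w/z)(1 - wz) F(z). Its coefficients, read at m - j, are the given vectors up to a constant
(`eigvecB_eq`). Simplicity follows from the constant Wronskian of two solutions, which vanishes at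
-∞.

Finally, let |w| < 1 and let x not be an eigenvalue. On the far left B is a small perturbation of
the free operator, whose distance to x is under control; on the far right the potential dominates.
So B - x controls all but finitely many coordinates, and compactness upgrades this to a lower bound
(`exists_norm_le_mul`). The range is then closed, and it is dense because the coefficients of B are
real and x is not an eigenvalue. -/

open Filter Topology

/-! ### Convolution with the coefficients of the `q`-exponential function -/

/-- The coefficients `uᵏ / (q; q)ₖ` of the `q`-exponential series `1 / (uz; q)_∞`. -/
noncomputable def qExpCoeff (q u : ℂ) (k : ℕ) : ℂ := u ^ k / qPoch q q k

/-- Convolution of a two-sided sequence with the coefficients of `1 / (uz; q)_∞`. -/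
noncomputable def qExpConv (q u : ℂ) (φ : ℤ → ℂ) (n : ℤ) : ℂ :=
  ∑' k : ℕ, qExpCoeff q u k * φ (n - k)

theorem one_sub_pow_succ_ne_zero {q : ℂ} (hq : ‖q‖ < 1) (k : ℕ) : 1 - q ^ (k + 1) ≠ 0 := by
  intro h
  have h1 : ‖q‖ ^ (k + 1) = 1 := by rw [← norm_pow, ← sub_eq_zero.mp h, norm_one]
  exact (pow_lt_one₀ (norm_nonneg q) hq k.succ_ne_zero).ne h1

theorem qPoch_succ (a q : ℂ) (k : ℕ) : qPoch a q (k + 1) = qPoch a q k * (1 - a * q ^ k) :=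
  Finset.prod_range_succ _ _

theorem qPoch_self_ne_zero {q : ℂ} (hq : ‖q‖ < 1) (k : ℕ) : qPoch q q k ≠ 0 :=
  Finset.prod_ne_zero_iff.mpr fun i _ => by
    rw [← pow_succ']; exact one_sub_pow_succ_ne_zero hq i

theorem qExpCoeff_zero (q u : ℂ) : qExpCoeff q u 0 = 1 := by simp [qExpCoeff, qPoch]

theorem qExpCoeff_mul (q u : ℂ) (k : ℕ) :
    qExpCoeff q (q * u) k = q ^ k * qExpCoeff q u k := by
  rw [qExpCoeff, qExpCoeff, mul_pow, mul_div_assoc]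

theorem one_sub_mul_qExpCoeff_succ {q : ℂ} (hq : ‖q‖ < 1) (u : ℂ) (k : ℕ) :
    (1 - q ^ (k + 1)) * qExpCoeff q u (k + 1) = u * qExpCoeff q u k := by
  have h1 := one_sub_pow_succ_ne_zero hq k
  have h2 := qPoch_self_ne_zero hq k
  rw [qExpCoeff, qExpCoeff, qPoch_succ, ← pow_succ']
  field_simp
  ring

theorem summable_of_ratio_tendsto {f : ℕ → ℂ} {g : ℕ → ℂ} {l : ℂ} (hl : ‖l‖ < 1)
    (hg : Tendsto g atTop (𝓝 l)) (h : ∀ k, f (k + 1) = g k * f k) : Summable f := by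
  obtain ⟨r, hr1, hr2⟩ := exists_between hl
  refine summable_of_ratio_norm_eventually_le hr2 ?_
  filter_upwards [hg.norm.eventually (gt_mem_nhds hr1)] with k hk
  rw [h, norm_mul]
  exact mul_le_mul_of_nonneg_right hk.le (norm_nonneg _)

theorem tendsto_one_sub_pow_succ {q : ℂ} (hq : ‖q‖ < 1) :
    Tendsto (fun k : ℕ => 1 - q ^ (k + 1)) atTop (𝓝 1) := by
  simpa using ((tendsto_pow_atTop_nhds_zero_of_norm_lt_one hq).comp
    (tendsto_add_atTop_nat 1)).const_sub 1

theorem summable_qExpCoeff {q u : ℂ} (hq : ‖q‖ < 1) (hu : ‖u‖ < 1) :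
    Summable (qExpCoeff q u) := by
  have h : Tendsto (fun k : ℕ => u / (1 - q ^ (k + 1))) atTop (𝓝 u) := by
    simpa [div_eq_mul_inv] using ((tendsto_one_sub_pow_succ hq).inv₀ one_ne_zero).const_mul u
  refine summable_of_ratio_tendsto hu h fun k => ?_
  rw [div_mul_eq_mul_div, ← one_sub_mul_qExpCoeff_succ hq,
    mul_div_cancel_left₀ _ (one_sub_pow_succ_ne_zero hq k)]

section Bounded

variable {q u : ℂ} {φ : ℤ → ℂ} {M : ℝ}

theorem summable_norm_qExpCoeff_mul (hq : ‖q‖ < 1) (hu : ‖u‖ < 1) (hφ : ∀ n, ‖φ n‖ ≤ M) (n : ℤ) :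
    Summable fun k : ℕ => ‖qExpCoeff q u k * φ (n - k)‖ := by
  refine ((summable_qExpCoeff hq hu).norm.mul_right M).of_nonneg_of_le
    (fun _ => norm_nonneg _) fun k => ?_
  rw [norm_mul]
  exact mul_le_mul_of_nonneg_left (hφ _) (norm_nonneg _)

theorem summable_qExpCoeff_mul (hq : ‖q‖ < 1) (hu : ‖u‖ < 1) (hφ : ∀ n, ‖φ n‖ ≤ M) (n : ℤ) :
    Summable fun k : ℕ => qExpCoeff q u k * φ (n - k) :=
  (summable_norm_qExpCoeff_mul hq hu hφ n).of_norm

theorem exists_norm_qExpConv_le (hq : ‖q‖ < 1) (hu : ‖u‖ < 1) (hφ : ∀ n, ‖φ n‖ ≤ M) :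
    ∃ C, ∀ n, ‖qExpConv q u φ n‖ ≤ C := by
  refine ⟨∑' k, ‖qExpCoeff q u k‖ * M, fun n => ?_⟩
  refine (norm_tsum_le_tsum_norm (summable_norm_qExpCoeff_mul hq hu hφ n)).trans ?_
  refine (summable_norm_qExpCoeff_mul hq hu hφ n).tsum_le_tsum (fun k => ?_)
    ((summable_qExpCoeff hq hu).norm.mul_right M)
  rw [norm_mul]
  exact mul_le_mul_of_nonneg_left (hφ _) (norm_nonneg _)

/-- Splitting off the first factor of `(uz; q)_∞`. -/
theorem qExpConv_sub (hq : ‖q‖ < 1) (hu : ‖u‖ < 1) (hφ : ∀ n, ‖φ n‖ ≤ M) (n : ℤ) :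
    qExpConv q u φ n - u * qExpConv q u φ (n - 1) = qExpConv q (q * u) φ n := by
  have hu' : ‖q * u‖ < 1 := by
    rw [norm_mul]; exact mul_lt_one_of_nonneg_of_lt_one_left (norm_nonneg _) hq hu.le
  have h1 := summable_qExpCoeff_mul hq hu hφ n
  have h2 := summable_qExpCoeff_mul hq hu' hφ n
  have h3 := (summable_qExpCoeff_mul hq hu hφ (n - 1)).mul_left u
  rw [qExpConv, qExpConv, qExpConv, ← tsum_mul_left, h1.tsum_eq_zero_add, h2.tsum_eq_zero_add,
    add_sub_assoc, ← ((summable_nat_add_iff 1).mpr h1).tsum_sub h3, qExpCoeff_zero, qExpCoeff_zero]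
  congr 1
  refine tsum_congr fun k => ?_
  have h4 : n - ((k + 1 : ℕ) : ℤ) = n - 1 - k := by push_cast; ring
  rw [h4, qExpCoeff_mul]
  linear_combination φ (n - 1 - k) * one_sub_mul_qExpCoeff_succ hq u k

/-- With P(z) = Φ(qz), this is 1/(quz; q)_∞ = (1 - uz)/(uz; q)_∞. Only `p` has to be bounded, which
allows `φ` to be the possibly unbounded q⁻ⁿψₙ. -/
theorem qExpConv_eq_sub_of_eq_zpow_mul (hq : ‖q‖ < 1) (hq0 : q ≠ 0) (hu : ‖u‖ < 1) {p : ℤ → ℂ}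
    (hp : ∀ n, ‖p n‖ ≤ M) (hpφ : ∀ n, p n = q ^ n * φ n) (n : ℤ) :
    q ^ n * qExpConv q u φ n = qExpConv q u p n - u * qExpConv q u p (n - 1) := by
  rw [qExpConv_sub hq hu hp, qExpConv, qExpConv, ← tsum_mul_left]
  refine tsum_congr fun k => ?_
  rw [hpφ, qExpCoeff_mul, show q ^ n = q ^ k * q ^ (n - k) by
    rw [← zpow_natCast, ← zpow_add₀ hq0]; congr 1; ring]
  ring

/-- By `qExpConv_sub`, vanishing passes from u to qu, hence to every qʲu. As j → ∞ the kernel tends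
to the unit mass at 0, so the convolution tends to `φ` itself. -/
theorem eq_zero_of_qExpConv_eq_zero (hq : ‖q‖ < 1) (hu : ‖u‖ < 1) (hφ : ∀ n, ‖φ n‖ ≤ M)
    (h : ∀ n, qExpConv q u φ n = 0) (n : ℤ) : φ n = 0 := by
  have hpow : ∀ j : ℕ, ‖q ^ j * u‖ < 1 := fun j => by
    rw [norm_mul, norm_pow]
    exact mul_lt_one_of_nonneg_of_lt_one_right (pow_le_one₀ (norm_nonneg _) hq.le)
      (norm_nonneg _) hu
  have h0 : ∀ (j : ℕ) (n : ℤ), qExpConv q (q ^ j * u) φ n = 0 := by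
    intro j
    induction j with
    | zero => simpa using h
    | succ j ih =>
      intro n
      have := qExpConv_sub hq (hpow j) hφ n
      rw [ih, ih] at this
      rw [pow_succ', mul_assoc, ← this]; simp
  have hc : ∀ j k : ℕ, qExpCoeff q (q ^ j * u) k = (q ^ j) ^ k * qExpCoeff q u k := fun j k => by
    rw [qExpCoeff, qExpCoeff, mul_pow, mul_div_assoc]
  have hlim : Tendsto (fun j : ℕ => qExpConv q (q ^ j * u) φ n) atTop
      (𝓝 (∑' k : ℕ, if k = 0 then φ n else 0)) := by
    refine tendsto_tsum_of_dominated_convergence (summable_norm_qExpCoeff_mul hq hu hφ n) ?_ ?_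
    · intro k
      rcases k with _ | k
      · simp [qExpCoeff_zero]
      · simp only [hc, Nat.add_eq_zero_iff, one_ne_zero, and_false, if_false]
        have h1 := (tendsto_pow_atTop_nhds_zero_of_norm_lt_one hq).pow (k + 1)
        simpa [mul_assoc] using h1.mul_const (qExpCoeff q u (k + 1) * φ (n - ((k + 1 : ℕ) : ℤ)))
    · refine Eventually.of_forall fun j k => ?_
      rw [hc, mul_assoc, norm_mul]
      refine mul_le_of_le_one_left (norm_nonneg _) ?_
      rw [norm_pow, norm_pow]
      exact pow_le_one₀ (by positivity) (pow_le_one₀ (norm_nonneg _) hq.le)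
  simp only [h0, tsum_ite_eq] at hlim
  exact tendsto_nhds_unique hlim tendsto_const_nhds

theorem tendsto_qExpConv_atBot (hq : ‖q‖ < 1) (hu : ‖u‖ < 1) (hφ : ∀ n, ‖φ n‖ ≤ M)
    (h : Tendsto φ atBot (𝓝 0)) : Tendsto (qExpConv q u φ) atBot (𝓝 0) := by
  have : Tendsto (qExpConv q u φ) atBot (𝓝 (∑' _ : ℕ, (0 : ℂ))) := by
    refine tendsto_tsum_of_dominated_convergence ((summable_qExpCoeff hq hu).norm.mul_right M) ?_ ?_
    · intro k
      have h1 : Tendsto (fun n : ℤ => n - (k : ℤ)) atBot atBot :=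
        tendsto_atBot_add_const_right _ (-(k : ℤ)) tendsto_id
      simpa using (h.comp h1).const_mul (qExpCoeff q u k)
    · refine Eventually.of_forall fun n k => ?_
      rw [norm_mul]
      exact mul_le_mul_of_nonneg_left (hφ _) (norm_nonneg _)
  simpa using this

end Bounded

theorem summable_qExpConv {q u : ℂ} {φ : ℤ → ℂ} (hq : ‖q‖ < 1) (hu : ‖u‖ < 1) (hφ : Summable φ) :
    Summable (qExpConv q u φ) := by
  have h := summable_mul_of_summable_norm hφ.norm (summable_qExpCoeff hq hu).norm
  -- This shear turns the product family over ℤ × ℕ into the convolution terms, so that summing over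
  -- k first is Fubini.
  let e : ℤ × ℕ ≃ ℤ × ℕ :=
    { toFun := fun p => (p.1 - p.2, p.2)
      invFun := fun p => (p.1 + p.2, p.2)
      left_inv := fun p => by simp
      right_inv := fun p => by simp }
  have h2 := (e.summable_iff.mpr h).prod
  refine h2.congr fun n => tsum_congr fun k => ?_
  simp [e, mul_comm]

/-! ### The eigenvalue equation -/

/-- Moving left the values can only increase, yet they tend to 0. Applied to norms, this is how
decay at -∞ forces a sequence to vanish. -/
theorem Int.nonpos_of_succ_le_of_tendsto_atBot {f : ℤ → ℝ} {N : ℤ} (h : ∀ n < N, f (n + 1) ≤ f n)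
    (hlim : Tendsto f atBot (𝓝 0)) {n : ℤ} (hn : n ≤ N) : f n ≤ 0 := by
  have hk : ∀ k : ℕ, f n ≤ f (n - k) := by
    intro k
    induction k with
    | zero => simp
    | succ k ih =>
      refine ih.trans ?_
      have := h (n - (k + 1 : ℕ)) (by push_cast; omega)
      rwa [show n - ((k + 1 : ℕ) : ℤ) + 1 = n - k by push_cast; ring] at this
  have h1 : Tendsto (fun k : ℕ => n - (k : ℤ)) atTop atBot :=
    tendsto_atBot_add_const_left _ n (tendsto_neg_atTop_atBot.comp tendsto_natCast_atTop_atTop)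
  exact ge_of_tendsto' (hlim.comp h1) hk

theorem tendsto_zpow_neg_atTop {q : ℝ} (hq0 : 0 < q) (hq1 : q < 1) :
    Tendsto (fun n : ℤ => q ^ (-n)) atTop atTop := by
  refine tendsto_atTop.mpr fun C => ?_
  obtain ⟨k, hk⟩ := pow_unbounded_of_one_lt C ((one_lt_inv₀ hq0).mpr hq1)
  filter_upwards [eventually_ge_atTop (k : ℤ)] with n hn
  refine hk.le.trans ?_
  rw [zpow_neg, ← inv_zpow, ← zpow_natCast]
  exact zpow_le_zpow_right₀ ((one_lt_inv₀ hq0).mpr hq1).le hn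

theorem tendsto_zpow_neg_atBot {q : ℝ} (hq0 : 0 < q) (hq1 : q < 1) :
    Tendsto (fun n : ℤ => q ^ (-n)) atBot (𝓝 0) := by
  have h := (tendsto_zpow_neg_atTop hq0 hq1).comp tendsto_neg_atBot_atTop
  refine h.inv_tendsto_atTop.congr fun n => ?_
  simp [zpow_neg]

theorem norm_ofReal_lt_one {q : ℝ} (hq0 : 0 < q) (hq1 : q < 1) : ‖(q : ℂ)‖ < 1 := by
  rwa [Complex.norm_real, Real.norm_of_nonneg hq0.le]

/-- The eigenvalue equation `ψₙ₋₁ + α q⁻ⁿ ψₙ + ψₙ₊₁ = x ψₙ`. -/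
def IsEigenSeq (α q : ℝ) (x : ℂ) (ψ : ℤ → ℂ) : Prop :=
  ∀ n : ℤ, ψ (n - 1) + (α : ℂ) * (q : ℂ) ^ (-n) * ψ n + ψ (n + 1) = x * ψ n

/-! ### Which values of w can carry an eigenvector -/

section Uniqueness

variable {α q M : ℝ} {w : ℂ} {ψ : ℤ → ℂ}

/-- Dividing the generating function of an eigenvector by `(qwz; q)_∞` turns the second order
recurrence into a first order one. -/
theorem IsEigenSeq.qExpConv_succ (hq0 : 0 < q) (hq1 : q < 1) (hw0 : w ≠ 0)
    (hw1 : ‖w‖ ≤ 1) (hM : ∀ n, ‖ψ n‖ ≤ M) (hlim : Tendsto ψ atBot (𝓝 0))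
    (hψ : IsEigenSeq α q (w + w⁻¹) ψ) (n : ℤ) :
    w * qExpConv q (q * w) ψ (n + 1)
      = (1 - (α : ℂ) * w * (q : ℂ) ^ (-n)) * qExpConv q (q * w) ψ n := by
  have hqn := norm_ofReal_lt_one hq0 hq1
  have hqc : (q : ℂ) ≠ 0 := by exact_mod_cast hq0.ne'
  -- Starting the product at qw rather than w keeps the convolution convergent when |w| = 1.
  have hu : ‖(q : ℂ) * w‖ < 1 := by
    rw [norm_mul]; exact mul_lt_one_of_nonneg_of_lt_one_left (norm_nonneg _) hqn hw1
  set h := qExpConv q (q * w) ψ with hh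
  have hs : ∀ n, α * qExpConv q (q * w) (fun n => (q : ℂ) ^ (-n) * ψ n) n
      = (w + w⁻¹) * h n - h (n - 1) - h (n + 1) := by
    intro n
    have s0 := (summable_qExpCoeff_mul hqn hu hM n).mul_left (w + w⁻¹)
    have s1 := summable_qExpCoeff_mul hqn hu hM (n - 1)
    have s2 := summable_qExpCoeff_mul hqn hu hM (n + 1)
    simp only [hh, qExpConv]
    rw [← tsum_mul_left, ← tsum_mul_left, ← s0.tsum_sub s1, ← (s0.sub s1).tsum_sub s2]
    refine tsum_congr fun k => ?_
    have e := hψ (n - k)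
    rw [show n - (k : ℤ) - 1 = n - 1 - k by ring, show n - (k : ℤ) + 1 = n + 1 - k by ring] at e
    linear_combination qExpCoeff q (q * w) k * e
  -- Coefficient form of Ψ(z/q) / (qwz; q)_∞ = (1 - wz) H(z/q).
  have key : ∀ n, qExpConv q (q * w) (fun n => (q : ℂ) ^ (-n) * ψ n) n
      = (q : ℂ) ^ (-n) * h n - w * ((q : ℂ) ^ (-(n - 1)) * h (n - 1)) := by
    intro n
    have e := qExpConv_eq_sub_of_eq_zpow_mul hqn hqc hu hM
      (φ := fun n => (q : ℂ) ^ (-n) * ψ n) (fun n => by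
        rw [← mul_assoc, ← zpow_add₀ hqc]; simp) n
    have e1 : (q : ℂ) ^ (-(n - 1)) = (q : ℂ) ^ (-n) * q := by
      rw [← zpow_add_one₀ hqc]; congr 1; ring
    have e2 : (q : ℂ) ^ (-n) * (q : ℂ) ^ n = 1 := by rw [← zpow_add₀ hqc]; simp
    rw [e1]
    linear_combination (q : ℂ) ^ (-n) * e
      - qExpConv q (q * w) (fun n => (q : ℂ) ^ (-n) * ψ n) n * e2
  -- `y` is the defect of the first order recurrence. The second order one only says (1 - wz) Y(z) =
  -- 0, and cancelling 1 - wz needs |w| ≤ 1 and decay at -∞.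
  set y : ℤ → ℂ := fun n => α * w * (q : ℂ) ^ (-n) * h n - (h n - w * h (n + 1)) with hy
  have hyrec : ∀ n, y (n + 1) = w * y n := by
    intro n
    have e1 := hs (n + 1)
    rw [key] at e1
    simp only [add_sub_cancel_right] at e1
    simp only [hy]
    have e2 : w * w⁻¹ = 1 := mul_inv_cancel₀ hw0
    linear_combination w * e1 + h (n + 1) * e2
  have hhlim : Tendsto h atBot (𝓝 0) := tendsto_qExpConv_atBot hqn hu hM hlim
  have hylim : Tendsto y atBot (𝓝 0) := by
    have h1 : Tendsto (fun n : ℤ => (q : ℂ) ^ (-n)) atBot (𝓝 0) := by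
      have := (Complex.continuous_ofReal.tendsto 0).comp (tendsto_zpow_neg_atBot hq0 hq1)
      simpa [Function.comp_def] using this
    have h2 : Tendsto (fun n : ℤ => h (n + 1)) atBot (𝓝 0) :=
      hhlim.comp (tendsto_atBot_add_const_right _ 1 tendsto_id)
    simpa [hy] using ((h1.const_mul (α * w)).mul hhlim).sub (hhlim.sub (h2.const_mul w))
  have hy0 : y n = 0 := by
    refine norm_le_zero_iff.mp (Int.nonpos_of_succ_le_of_tendsto_atBot (f := fun n => ‖y n‖)
      (N := n) (fun n _ => ?_) (by simpa using hylim.norm) le_rfl)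
    rw [hyrec, norm_mul]
    exact mul_le_of_le_one_left (norm_nonneg _) hw1
  simp only [hy] at hy0
  linear_combination hy0

theorem IsEigenSeq.exists_zpow (hq0 : 0 < q) (hq1 : q < 1) (hα : α ≠ 0) (hw0 : w ≠ 0)
    (hw1 : ‖w‖ ≤ 1) (hM : ∀ n, ‖ψ n‖ ≤ M) (hlim : Tendsto ψ atBot (𝓝 0))
    (hψ : IsEigenSeq α q (w + w⁻¹) ψ) (hne : ∃ n, ψ n ≠ 0) :
    ‖w‖ < 1 ∧ ∃ m : ℤ, (α : ℂ) * w = (q : ℂ) ^ m := by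
  have hqn := norm_ofReal_lt_one hq0 hq1
  have hqc : (q : ℂ) ≠ 0 := by exact_mod_cast hq0.ne'
  have hu : ‖(q : ℂ) * w‖ < 1 := by
    rw [norm_mul]; exact mul_lt_one_of_nonneg_of_lt_one_left (norm_nonneg _) hqn hw1
  have hrec := hψ.qExpConv_succ hq0 hq1 hw0 hw1 hM hlim
  obtain ⟨C, hC⟩ := exists_norm_qExpConv_le hqn hu hM
  have hhlim : Tendsto (qExpConv q (q * w) ψ) atBot (𝓝 0) := tendsto_qExpConv_atBot hqn hu hM hlim
  have hhne : ¬ ∀ n, qExpConv q (q * w) ψ n = 0 := fun h0 => by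
    obtain ⟨n, hn⟩ := hne
    exact hn (eq_zero_of_qExpConv_eq_zero hqn hu hM h0 n)
  generalize qExpConv q (q * w) ψ = h at hrec hC hhlim hhne
  have hex : ∃ m : ℤ, (α : ℂ) * w = (q : ℂ) ^ m := by
    by_contra! hcon
    apply hhne
    have hfac : ∀ n : ℤ, 1 - (α : ℂ) * w * (q : ℂ) ^ (-n) ≠ 0 := by
      intro n h0
      apply hcon n
      rw [zpow_neg, ← div_eq_mul_inv, sub_eq_zero, eq_comm,
        div_eq_one_iff_eq (zpow_ne_zero _ hqc)] at h0
      exact h0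
    -- Once |αw| q⁻ⁿ ≥ 3 the factor has modulus at least 2; this doubling contradicts the bound `C`
    -- unless h vanishes far to the right.
    have hgrow : ∀ᶠ n : ℤ in atTop, 2 * ‖h n‖ ≤ ‖h (n + 1)‖ := by
      have hpos : 0 < |α| * ‖w‖ := mul_pos (abs_pos.mpr hα) (norm_pos_iff.mpr hw0)
      have ht := (tendsto_zpow_neg_atTop hq0 hq1).const_mul_atTop hpos
      filter_upwards [ht.eventually_ge_atTop 3] with n hn
      have e1 : ‖w‖ * ‖h (n + 1)‖ = ‖1 - (α : ℂ) * w * (q : ℂ) ^ (-n)‖ * ‖h n‖ := by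
        rw [← norm_mul, hrec, norm_mul]
      have e2 : ‖(α : ℂ) * w * (q : ℂ) ^ (-n)‖ = |α| * ‖w‖ * q ^ (-n) := by
        rw [norm_mul, norm_mul, norm_zpow, Complex.norm_real, Complex.norm_real,
          Real.norm_of_nonneg hq0.le, Real.norm_eq_abs]
      have e3 := norm_sub_norm_le ((α : ℂ) * w * (q : ℂ) ^ (-n)) 1
      rw [norm_sub_rev, e2, norm_one] at e3
      have e4 : 2 * ‖h n‖ ≤ ‖w‖ * ‖h (n + 1)‖ := by
        rw [e1]; exact mul_le_mul_of_nonneg_right (by linarith) (norm_nonneg _)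
      exact e4.trans (mul_le_of_le_one_left (norm_nonneg _) hw1)
    obtain ⟨N, hN⟩ := eventually_atTop.mp hgrow
    have hzero : ∀ n ≥ N, h n = 0 := by
      intro n hn
      by_contra hne0
      have hp : ∀ k : ℕ, 2 ^ k * ‖h n‖ ≤ ‖h (n + k)‖ := by
        intro k
        induction k with
        | zero => simp
        | succ k ih =>
          have := hN (n + k) (by omega)
          rw [Nat.cast_succ, ← add_assoc, pow_succ]
          linarith
      obtain ⟨k, hk⟩ := pow_unbounded_of_one_lt (C / ‖h n‖) (one_lt_two (α := ℝ))
      rw [div_lt_iff₀ (norm_pos_iff.mpr hne0)] at hk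
      exact absurd (hk.trans_le ((hp k).trans (hC _))) (lt_irrefl _)
    intro n
    rcases le_total N n with hn | hn
    · exact hzero n hn
    · induction n, hn using Int.leInductionDown with
      | base => exact hzero N le_rfl
      | pred n _ ih =>
        have := hrec (n - 1)
        rw [sub_add_cancel, ih, mul_zero] at this
        exact (mul_eq_zero.mp this.symm).resolve_left (hfac _)
  refine ⟨lt_of_le_of_ne hw1 fun hw => hhne ?_, hex⟩
  obtain ⟨m, hm⟩ := hex
  have hfac : ∀ n : ℤ, 1 - (α : ℂ) * w * (q : ℂ) ^ (-n) = ((1 - q ^ (m - n) : ℝ) : ℂ) := by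
    intro n
    rw [hm, ← zpow_add₀ hqc, ← sub_eq_add_neg]
    push_cast
    rfl
  have hnorm : ∀ n, ‖h (n + 1)‖ = |1 - q ^ (m - n)| * ‖h n‖ := by
    intro n
    have := congrArg norm (hrec n)
    rwa [norm_mul, hw, one_mul, norm_mul, hfac, Complex.norm_real, Real.norm_eq_abs] at this
  -- For n < m the factor 1 - q^(m-n) lies in [0, 1], so with |w| = 1 the norms do not increase to
  -- the right, although they start from 0 at -∞.
  have hle : ∀ n ≤ m, h n = 0 := by
    intro n hn
    refine norm_le_zero_iff.mp (Int.nonpos_of_succ_le_of_tendsto_atBot (f := fun n => ‖h n‖)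
      (N := m) (fun n hn => ?_) (by simpa using hhlim.norm) hn)
    show ‖h (n + 1)‖ ≤ ‖h n‖
    rw [hnorm]
    refine mul_le_of_le_one_left (norm_nonneg _) ?_
    have h1 : q ^ (m - n) ≤ 1 := zpow_le_one₀ hq0 hq1.le (by omega)
    have h2 : 0 < q ^ (m - n) := zpow_pos hq0 _
    rw [abs_le]; constructor <;> linarith
  intro n
  rcases le_total n m with hn | hn
  · exact hle n hn
  · induction n, hn using Int.leInduction with
    | base => exact hle m le_rfl
    | succ n _ ih => rw [← norm_eq_zero, hnorm, ih, norm_zero, mul_zero]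

end Uniqueness

/-! ### The eigenvectors -/

theorem qPochInf_zpow (q : ℂ) (hq : ‖q‖ < 1) (hq0 : q ≠ 0) (i : ℤ) :
    qPochInf (q ^ i) q = (1 - q ^ i) * qPochInf (q ^ (i + 1)) q := by
  rw [qPochInf_eq (q ^ i) q hq 1, pow_one, ← zpow_add_one₀ hq0]
  simp [qPoch]

theorem qPochInf_zpow_of_nonpos (q : ℂ) (hq : ‖q‖ < 1) (hq0 : q ≠ 0) {i : ℤ} (hi : i ≤ 0) :
    qPochInf (q ^ i) q = 0 := by
  induction i, hi using Int.leInductionDown with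
  | base => rw [qPochInf_zpow q hq hq0]; simp
  | pred i _ ih => rw [qPochInf_zpow q hq hq0, sub_add_cancel, ih, mul_zero]

theorem qPochInf_self_ne_zero {q : ℂ} (hq : ‖q‖ < 1) : qPochInf q q ≠ 0 := by
  have h : qPochInf q q = ∏' i : ℕ, (1 + -(q ^ (i + 1))) :=
    tprod_congr fun i => by rw [pow_succ', sub_eq_add_neg]
  rw [h]
  refine tprod_one_add_ne_zero_of_summable (fun i => ?_) ?_
  · rw [← sub_eq_add_neg]; exact one_sub_pow_succ_ne_zero hq i
  · simp only [norm_neg, norm_pow]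
    exact (summable_nat_add_iff 1).mpr (summable_geometric_of_lt_one (norm_nonneg _) hq)

/-- Up to the factor `(q; q)_∞`, the coefficients of `(qw/z; q)_∞`. -/
noncomputable def qExpDual (q w : ℂ) (n : ℤ) : ℂ :=
  qPochInf (q ^ (-n + 1)) q * (-w) ^ (-n) * q ^ (-n * (-n + 1) / 2)

theorem two_mul_tri (n : ℤ) : 2 * (n * (n + 1) / 2) = n * (n + 1) :=
  Int.mul_ediv_cancel' (Int.even_mul_succ_self n).two_dvd

section Dual

variable {q w : ℂ}

/-- Coefficient form of D(qz) = (1 - w/z) D(z) for D(z) = (qw/z; q)_∞. -/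
theorem zpow_mul_qExpDual (hq : ‖q‖ < 1) (hq0 : q ≠ 0) (hw : w ≠ 0) (n : ℤ) :
    q ^ n * qExpDual q w n = qExpDual q w n - w * qExpDual q w (n + 1) := by
  have e1 : -(n + 1) + 1 = -n := by ring
  have e2 : (-w) ^ (-n) = (-w) ^ (-(n + 1)) * (-w) := by
    rw [← zpow_add_one₀ (neg_ne_zero.mpr hw), e1]
  have e3 : q ^ (-n * (-n + 1) / 2) = q ^ (-(n + 1) * (-(n + 1) + 1) / 2) * q ^ (-n) := by
    rw [← zpow_add₀ hq0]
    congr 1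
    have h1 := two_mul_tri (-n)
    have h2 := two_mul_tri (-(n + 1))
    have h3 : -n * (-n + 1) = -(n + 1) * (-(n + 1) + 1) + 2 * (-n) := by ring
    omega
  have e4 : q ^ n * q ^ (-n) = 1 := by rw [← zpow_add₀ hq0]; simp
  rw [qExpDual, qExpDual, e3, e2, e1, qPochInf_zpow q hq hq0 (-n)]
  linear_combination (-w * (-w) ^ (-(n + 1)) * q ^ (-(n + 1) * -n / 2) *
    qPochInf (q ^ (-n + 1)) q) * e4

theorem qExpDual_of_pos (hq : ‖q‖ < 1) (hq0 : q ≠ 0) {n : ℤ} (hn : 0 < n) :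
    qExpDual q w n = 0 := by
  rw [qExpDual, qPochInf_zpow_of_nonpos q hq hq0 (by omega), zero_mul, zero_mul]

theorem qExpDual_zero_ne_zero (hq : ‖q‖ < 1) : qExpDual q w 0 ≠ 0 := by
  simpa [qExpDual] using qPochInf_self_ne_zero hq

theorem summable_qExpDual (hq : ‖q‖ < 1) (hq0 : q ≠ 0) (hw : w ≠ 0) :
    Summable (qExpDual q w) := by
  have hinj : Function.Injective fun k : ℕ => -(k : ℤ) := fun a b h => by simpa using h
  rw [← hinj.summable_iff]
  · have hg : Tendsto (fun k : ℕ => -(w * q ^ (k + 1)) * (1 - q ^ (k + 1))⁻¹) atTop (𝓝 0) := by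
      have h1 := (tendsto_pow_atTop_nhds_zero_of_norm_lt_one hq).comp (tendsto_add_atTop_nat 1)
      simpa using (h1.const_mul w).neg.mul ((tendsto_one_sub_pow_succ hq).inv₀ one_ne_zero)
    refine summable_of_ratio_tendsto (by simp) hg fun k => ?_
    have h1 := zpow_mul_qExpDual hq hq0 hw (-((k : ℤ) + 1))
    have h2 := one_sub_pow_succ_ne_zero hq k
    rw [zpow_neg, show -((k : ℤ) + 1) + 1 = -k by ring,
      show q ^ ((k : ℤ) + 1) = q ^ (k + 1) by exact_mod_cast zpow_natCast q (k + 1)] at h1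
    have h3 : q ^ (k + 1) ≠ 0 := pow_ne_zero _ hq0
    simp only [Function.comp_apply, Nat.cast_succ]
    field_simp at h1 ⊢
    linear_combination h1
  · intro n hn
    refine qExpDual_of_pos hq hq0 (not_le.mp fun h => hn ⟨(-n).toNat, ?_⟩)
    simp only
    omega

theorem exists_norm_qExpDual_le (hq : ‖q‖ < 1) (hq0 : q ≠ 0) (hw : w ≠ 0) :
    ∃ M, ∀ n, ‖qExpDual q w n‖ ≤ M :=
  ⟨_, fun n => (summable_qExpDual hq hq0 hw).norm.le_tsum n fun _ _ => norm_nonneg _⟩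

/-- The second order recurrence for the coefficients of `(qw/z; q)_∞ / (wz; q)_∞`. -/
theorem zpow_mul_qExpConv_qExpDual (hq : ‖q‖ < 1) (hq0 : q ≠ 0) (hw0 : w ≠ 0) (hw1 : ‖w‖ < 1)
    (n : ℤ) : q ^ n * qExpConv q w (qExpDual q w) n = (1 + w ^ 2) * qExpConv q w (qExpDual q w) n
      - w * qExpConv q w (qExpDual q w) (n + 1) - w * qExpConv q w (qExpDual q w) (n - 1) := by
  obtain ⟨M, hM⟩ := exists_norm_qExpDual_le hq hq0 hw0
  have hp : ∀ n, ‖qExpDual q w n - w * qExpDual q w (n + 1)‖ ≤ M + ‖w‖ * M := fun n => by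
    refine (norm_sub_le _ _).trans (add_le_add (hM _) ?_)
    rw [norm_mul]
    exact mul_le_mul_of_nonneg_left (hM _) (norm_nonneg _)
  have hconv : ∀ n, qExpConv q w (fun n => qExpDual q w n - w * qExpDual q w (n + 1)) n
      = qExpConv q w (qExpDual q w) n - w * qExpConv q w (qExpDual q w) (n + 1) := fun n => by
    have s0 := summable_qExpCoeff_mul hq hw1 hM n
    have s1 := (summable_qExpCoeff_mul hq hw1 hM (n + 1)).mul_left w
    simp only [qExpConv]
    rw [← tsum_mul_left, ← s0.tsum_sub s1]
    refine tsum_congr fun k => ?_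
    rw [show n - (k : ℤ) + 1 = n + 1 - k by ring]
    ring
  rw [qExpConv_eq_sub_of_eq_zpow_mul hq hq0 hw1 hp
    (fun n => (zpow_mul_qExpDual hq hq0 hw0 n).symm), hconv, hconv, sub_add_cancel]
  ring

end Dual

section Eigenvector

variable {α q : ℝ}

theorem eigvalB_eq (α q : ℝ) (m : ℤ) :
    eigvalB α q m = (α : ℂ)⁻¹ * (q : ℂ) ^ m + ((α : ℂ)⁻¹ * (q : ℂ) ^ m)⁻¹ := by
  rw [eigvalB, mul_inv, inv_inv, zpow_neg]

/-- The two series agree term by term: the k-th term of ₁φ̃₁ is the k-th term of the convolution,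
once the powers of -1, α and q are matched separately. -/
theorem eigvecB_eq (hq0 : 0 < q) (hα : α ≠ 0) (m j : ℤ) :
    eigvecB α q m j = (-1) ^ m * (α : ℂ) ^ (-m) * (q : ℂ) ^ (m * (m + 1) / 2) *
      qExpConv q ((α : ℂ)⁻¹ * (q : ℂ) ^ m) (qExpDual q ((α : ℂ)⁻¹ * (q : ℂ) ^ m)) (m - j) := by
  have hqc : (q : ℂ) ≠ 0 := by exact_mod_cast hq0.ne'
  have hαc : (α : ℂ) ≠ 0 := by exact_mod_cast hα
  rw [eigvecB, regPhiOneOne, qExpConv, ← tsum_mul_left, ← tsum_mul_left]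
  refine tsum_congr fun k => ?_
  have hp : qPoch 0 q k = 1 := by simp [qPoch]
  have e1 : (q : ℂ) ^ (-m + j + 1) * (q : ℂ) ^ k = (q : ℂ) ^ (-(m - j - k) + 1) := by
    rw [← zpow_natCast, ← zpow_add₀ hqc]; congr 1; ring
  rw [qExpDual, qExpCoeff, hp, e1]
  obtain ⟨i, hi⟩ : ∃ i : ℤ, i = -(m - j - k) := ⟨_, rfl⟩
  rw [← hi]
  have e2 : ((-1 : ℂ)) ^ j * (-1) ^ k = (-1) ^ m * (-1) ^ i := by
    rw [← zpow_natCast, ← zpow_add₀ (by norm_num), ← zpow_add₀ (by norm_num)]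
    congr 1; omega
  have e3 : (-((α : ℂ)⁻¹ * (q : ℂ) ^ m)) ^ i = (-1) ^ i * (α : ℂ) ^ (-i) * (q : ℂ) ^ (m * i) := by
    rw [neg_eq_neg_one_mul, mul_zpow, mul_zpow, inv_zpow', zpow_mul, mul_assoc]
  have e4 : ((α : ℂ)⁻¹ * (q : ℂ) ^ m) ^ k = (α : ℂ) ^ (-(k : ℤ)) * (q : ℂ) ^ (m * k) := by
    rw [mul_pow, inv_pow, zpow_mul, zpow_neg, zpow_natCast, zpow_natCast]
  have e5 : ((α : ℂ) ^ (-2 : ℤ) * (q : ℂ) ^ (m + j + 1)) ^ k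
      = (α : ℂ) ^ (-2 * (k : ℤ)) * (q : ℂ) ^ ((m + j + 1) * k) := by
    rw [mul_pow, zpow_mul, zpow_mul, zpow_natCast, zpow_natCast]
  have e6 : (α : ℂ) ^ (-j) * (α : ℂ) ^ (-2 * (k : ℤ))
      = (α : ℂ) ^ (-m) * (α : ℂ) ^ (-i) * (α : ℂ) ^ (-(k : ℤ)) := by
    rw [← zpow_add₀ hαc, ← zpow_add₀ hαc, ← zpow_add₀ hαc]
    congr 1; omega
  have e7 : (q : ℂ) ^ (j * (j + 1) / 2) * (q : ℂ) ^ (k.choose 2) * (q : ℂ) ^ ((m + j + 1) * k)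
      = (q : ℂ) ^ (m * (m + 1) / 2) * (q : ℂ) ^ (i * (i + 1) / 2) * (q : ℂ) ^ (m * i)
        * (q : ℂ) ^ (m * k) := by
    rw [← zpow_natCast (q : ℂ) (k.choose 2)]
    simp only [← zpow_add₀ hqc]
    congr 1
    -- Doubling the exponents removes the integer divisions by 2.
    have h1 := two_mul_tri j
    have h2 := two_mul_tri m
    have h3 := two_mul_tri i
    have h4 : 2 * ((k.choose 2 : ℕ) : ℤ) = k * (k - 1) := by
      rw [Nat.choose_two_right]
      have := Nat.div_mul_cancel (Nat.even_mul_pred_self k).two_dvd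
      zify at this
      rcases k with _ | k
      · simp
      · push_cast at this ⊢
        simp only [add_sub_cancel_right] at this ⊢
        linarith
    have h5 : j * (j + 1) + k * (k - 1) + 2 * ((m + j + 1) * k)
        = m * (m + 1) + i * (i + 1) + 2 * (m * i) + 2 * (m * k) := by
      rw [hi]; ring
    omega
  rw [e3, e4, e5]
  calc _ = ((-1 : ℂ) ^ j * (-1) ^ k) * ((α : ℂ) ^ (-j) * (α : ℂ) ^ (-2 * (k : ℤ))) *
        ((q : ℂ) ^ (j * (j + 1) / 2) * (q : ℂ) ^ (k.choose 2) * (q : ℂ) ^ ((m + j + 1) * k)) *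
        (qPochInf ((q : ℂ) ^ (i + 1)) q / qPoch q q k) := by ring
    _ = _ := by rw [e2, e6, e7]; ring

theorem isEigenSeq_eigvecB (hq0 : 0 < q) (hq1 : q < 1) (hα : α ≠ 0) {m : ℤ}
    (hw : ‖(α : ℂ)⁻¹ * (q : ℂ) ^ m‖ < 1) :
    IsEigenSeq α q (eigvalB α q m) (eigvecB α q m) := by
  have hqc : (q : ℂ) ≠ 0 := by exact_mod_cast hq0.ne'
  have hαc : (α : ℂ) ≠ 0 := by exact_mod_cast hα
  intro j
  have hw0 : (α : ℂ)⁻¹ * (q : ℂ) ^ m ≠ 0 := mul_ne_zero (inv_ne_zero hαc) (zpow_ne_zero _ hqc)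
  have h := zpow_mul_qExpConv_qExpDual (norm_ofReal_lt_one hq0 hq1) hqc hw0 hw (m - j)
  -- The reflection n = m - j turns the weight qⁿ of the recurrence into the potential αq⁻ʲ.
  have e : (α : ℂ) * (q : ℂ) ^ (-j) = ((α : ℂ)⁻¹ * (q : ℂ) ^ m)⁻¹ * (q : ℂ) ^ (m - j) := by
    rw [mul_inv, inv_inv, ← zpow_neg, mul_assoc, ← zpow_add₀ hqc]; congr 2; ring
  rw [e, eigvalB_eq]
  simp only [eigvecB_eq hq0 hα]
  rw [show m - (j - 1) = m - j + 1 by ring, show m - (j + 1) = m - j - 1 by ring]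
  generalize (α : ℂ)⁻¹ * (q : ℂ) ^ m = w at *
  generalize (-1 : ℂ) ^ m * (α : ℂ) ^ (-m) * (q : ℂ) ^ (m * (m + 1) / 2) = c
  field_simp
  linear_combination c * h

theorem summable_eigvecB (hq0 : 0 < q) (hq1 : q < 1) (hα : α ≠ 0) {m : ℤ}
    (hw : ‖(α : ℂ)⁻¹ * (q : ℂ) ^ m‖ < 1) : Summable (eigvecB α q m) := by
  have hqc : (q : ℂ) ≠ 0 := by exact_mod_cast hq0.ne'
  have hαc : (α : ℂ) ≠ 0 := by exact_mod_cast hα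
  have hw0 : (α : ℂ)⁻¹ * (q : ℂ) ^ m ≠ 0 := mul_ne_zero (inv_ne_zero hαc) (zpow_ne_zero _ hqc)
  have hqn := norm_ofReal_lt_one hq0 hq1
  have h := summable_qExpConv hqn hw (summable_qExpDual hqn hqc hw0)
  exact (((Equiv.subLeft m).summable_iff.mpr h).mul_left _).congr
    fun j => (eigvecB_eq hq0 hα m j).symm

theorem exists_eigvecB_ne_zero (hq0 : 0 < q) (hq1 : q < 1) (hα : α ≠ 0) {m : ℤ}
    (hw : ‖(α : ℂ)⁻¹ * (q : ℂ) ^ m‖ < 1) : ∃ j, eigvecB α q m j ≠ 0 := by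
  have hqc : (q : ℂ) ≠ 0 := by exact_mod_cast hq0.ne'
  have hαc : (α : ℂ) ≠ 0 := by exact_mod_cast hα
  have hw0 : (α : ℂ)⁻¹ * (q : ℂ) ^ m ≠ 0 := mul_ne_zero (inv_ne_zero hαc) (zpow_ne_zero _ hqc)
  have hqn := norm_ofReal_lt_one hq0 hq1
  by_contra! hcon
  obtain ⟨M, hM⟩ := exists_norm_qExpDual_le hqn hqc hw0
  refine qExpDual_zero_ne_zero hqn (eq_zero_of_qExpConv_eq_zero hqn hw hM (fun n => ?_) 0)
  have h := hcon (m - n)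
  rw [eigvecB_eq hq0 hα, sub_sub_cancel] at h
  refine (mul_eq_zero.mp h).resolve_left (mul_ne_zero (mul_ne_zero ?_ ?_) ?_)
  · exact zpow_ne_zero _ (by norm_num)
  · exact zpow_ne_zero _ hαc
  · exact zpow_ne_zero _ hqc

end Eigenvector

/-! ### Operators on `ℓ²(ℤ)` -/

/-- The shifted sequence `(ψₙ₊ₖ)ₙ`. -/
noncomputable def ellShift (k : ℤ) (ψ : EllTwo) : EllTwo :=
  ⟨fun n => ψ (n + k), memlp_shift ψ k⟩

theorem norm_ellShift (k : ℤ) (ψ : EllTwo) : ‖ellShift k ψ‖ = ‖ψ‖ := by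
  rw [lp.norm_eq_tsum_rpow (by norm_num), lp.norm_eq_tsum_rpow (by norm_num)]
  congr 1
  exact (Equiv.addRight k).tsum_eq fun n => ‖ψ n‖ ^ (2 : ENNReal).toReal

theorem EllTwo.norm_le_mul_of_forall {φ ψ : EllTwo} {C : ℝ} (hC : 0 ≤ C)
    (h : ∀ n, ‖φ n‖ ≤ C * ‖ψ n‖) : ‖φ‖ ≤ C * ‖ψ‖ := by
  have h1 : ‖φ‖ ≤ ‖(C : ℂ) • ψ‖ := lp.norm_mono (by norm_num) fun n => by
    rw [lp.coeFn_smul, Pi.smul_apply, norm_smul, Complex.norm_real, Real.norm_of_nonneg hC]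
    exact h n
  rwa [norm_smul, Complex.norm_real, Real.norm_of_nonneg hC] at h1

theorem EllTwo.exists_of_forall_norm_le (f : ℤ → ℂ) (ψ : EllTwo) {C : ℝ}
    (h : ∀ n, ‖f n‖ ≤ C * ‖ψ n‖) : ∃ φ : EllTwo, ∀ n, φ n = f n :=
  ⟨⟨f, (((lp.memℓp ψ).norm).const_mul C).mono h⟩, fun _ => rfl⟩

theorem EllTwo.norm_apply_le (ψ : EllTwo) (n : ℤ) : ‖ψ n‖ ≤ ‖ψ‖ :=
  lp.norm_apply_le_norm (by norm_num) ψ n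

theorem EllTwo.tendsto_apply {ι : Type*} {l : Filter ι} {f : ι → EllTwo} {ψ : EllTwo}
    (h : Tendsto f l (𝓝 ψ)) (n : ℤ) : Tendsto (fun i => f i n) l (𝓝 (ψ n)) := by
  rw [tendsto_iff_norm_sub_tendsto_zero] at h ⊢
  exact squeeze_zero (fun _ => norm_nonneg _) (fun i => EllTwo.norm_apply_le (f i - ψ) n) h

theorem EllTwo.tendsto_cofinite (ψ : EllTwo) : Tendsto (fun n => ψ n) cofinite (𝓝 0) := by
  have h := ((lp.memℓp ψ).summable (by norm_num)).tendsto_cofinite_zero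
  simp only [ENNReal.toReal_ofNat, Real.rpow_ofNat] at h
  rw [tendsto_zero_iff_norm_tendsto_zero]
  simpa using h.sqrt

theorem EllTwo.tendsto_atBot (ψ : EllTwo) : Tendsto (fun n => ψ n) atBot (𝓝 0) :=
  ψ.tendsto_cofinite.mono_left (by rw [Int.cofinite_eq]; exact le_sup_left)

/-! ### Elementary properties of the operator -/

section Basic

variable {α q : ℝ} {x : ℂ}

theorem opB_sub_smul_apply (ψ : (opB α q).domain) (n : ℤ) :
    (opB α q ψ - x • (ψ : EllTwo)) n = (ψ : EllTwo) (n - 1)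
      + (α : ℂ) * (q : ℂ) ^ (-n) * (ψ : EllTwo) n + (ψ : EllTwo) (n + 1)
      - x * (ψ : EllTwo) n := rfl

/-- Domain membership is automatic: the equation expresses αq⁻ⁿψₙ through ℓ² sequences, and α ≠ 0.
-/
theorem exists_mem_domain_of_forall (hα : α ≠ 0) {ψ η : EllTwo}
    (h : ∀ n, ψ (n - 1) + (α : ℂ) * (q : ℂ) ^ (-n) * ψ n + ψ (n + 1) - x * ψ n = η n) :
    ∃ hd : ψ ∈ (opB α q).domain, opB α q ⟨ψ, hd⟩ - x • ψ = η := by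
  have hαc : (α : ℂ) ≠ 0 := by exact_mod_cast hα
  have hd : ψ ∈ (opB α q).domain := by
    show Memℓp (fun n : ℤ => (q : ℂ) ^ (-n) * ψ n) 2
    convert lp.memℓp ((α : ℂ)⁻¹ • (η + x • ψ - ellShift (-1) ψ - ellShift 1 ψ)) using 1
    funext n
    show _ = (α : ℂ)⁻¹ * (η n + x * ψ n - ψ (n + -1) - ψ (n + 1))
    rw [← h n, ← sub_eq_add_neg]
    field_simp
    ring
  exact ⟨hd, lp.ext (funext h)⟩

theorem mem_opEigenspace_opB_iff (hα : α ≠ 0) (ψ : EllTwo) :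
    ψ ∈ opEigenspace (opB α q) x ↔ IsEigenSeq α q x ψ := by
  rw [mem_opEigenspace_iff]
  constructor
  · rintro ⟨hd, h⟩ n
    exact congrArg (fun φ : EllTwo => φ n) h
  · intro h
    obtain ⟨hd, h'⟩ := exists_mem_domain_of_forall (q := q) (x := x) (ψ := ψ) (η := 0) hα
      fun n => sub_eq_zero.mpr (h n)
    exact ⟨hd, sub_eq_zero.mp h'⟩

theorem mem_pointSpectrum_opB_iff (hα : α ≠ 0) :
    x ∈ pointSpectrum (opB α q) ↔ ∃ ψ : EllTwo, IsEigenSeq α q x ψ ∧ ψ ≠ 0 := by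
  show opEigenspace (opB α q) x ≠ ⊥ ↔ _
  rw [Submodule.ne_bot_iff]
  simp only [mem_opEigenspace_opB_iff hα]

end Basic

/-! ### Simplicity -/

section Simple

variable {α q : ℝ} {x : ℂ} {φ ψ : ℤ → ℂ}

theorem IsEigenSeq.wronskian_succ (hφ : IsEigenSeq α q x φ) (hψ : IsEigenSeq α q x ψ) (n : ℤ) :
    φ (n + 1) * ψ (n + 1 + 1) - φ (n + 1 + 1) * ψ (n + 1)
      = φ n * ψ (n + 1) - φ (n + 1) * ψ n := by
  have h1 := hφ (n + 1)
  have h2 := hψ (n + 1)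
  rw [add_sub_cancel_right] at h1 h2
  linear_combination φ (n + 1) * h2 - ψ (n + 1) * h1

theorem IsEigenSeq.wronskian_eq_zero (hφ : IsEigenSeq α q x φ) (hψ : IsEigenSeq α q x ψ)
    (hφ0 : Tendsto φ atBot (𝓝 0)) (hψ0 : Tendsto ψ atBot (𝓝 0)) (n : ℤ) :
    φ n * ψ (n + 1) - φ (n + 1) * ψ n = 0 := by
  have hs : Tendsto (fun n : ℤ => n + 1) atBot atBot :=
    tendsto_atBot_add_const_right _ 1 tendsto_id
  have hlim : Tendsto (fun n : ℤ => φ n * ψ (n + 1) - φ (n + 1) * ψ n) atBot (𝓝 0) := by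
    simpa using (hφ0.mul (hψ0.comp hs)).sub ((hφ0.comp hs).mul hψ0)
  refine norm_le_zero_iff.mp (Int.nonpos_of_succ_le_of_tendsto_atBot
    (f := fun n => ‖φ n * ψ (n + 1) - φ (n + 1) * ψ n‖) (N := n) (fun n _ => ?_)
    (by simpa using hlim.norm) le_rfl)
  show ‖_‖ ≤ ‖_‖
  rw [hφ.wronskian_succ hψ]

theorem IsEigenSeq.eq_zero_of_eq_zero (hψ : IsEigenSeq α q x ψ) {a : ℤ} (h0 : ψ a = 0)
    (h1 : ψ (a + 1) = 0) (n : ℤ) : ψ n = 0 := by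
  suffices h : ψ n = 0 ∧ ψ (n + 1) = 0 from h.1
  rcases le_total a n with hn | hn
  · induction n, hn using Int.leInduction with
    | base => exact ⟨h0, h1⟩
    | succ n _ ih =>
      have := hψ (n + 1)
      rw [add_sub_cancel_right, ih.1, ih.2] at this
      exact ⟨ih.2, by simpa using this⟩
  · induction n, hn using Int.leInductionDown with
    | base => exact ⟨h0, h1⟩
    | pred n _ ih =>
      have := hψ n
      rw [ih.1, ih.2] at this
      exact ⟨by simpa using this, by rw [sub_add_cancel]; exact ih.1⟩

/-- Subtract the multiple of `φ` that agrees with `ψ` at `a`. The zero Wronskian makes the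
difference vanish at a + 1 too, and the recurrence propagates this. -/
theorem IsEigenSeq.exists_eq_mul (hφ : IsEigenSeq α q x φ) (hψ : IsEigenSeq α q x ψ)
    (hφ0 : Tendsto φ atBot (𝓝 0)) (hψ0 : Tendsto ψ atBot (𝓝 0)) {a : ℤ} (ha : φ a ≠ 0) :
    ∃ c : ℂ, ∀ n, ψ n = c * φ n := by
  refine ⟨ψ a / φ a, fun n => sub_eq_zero.mp ?_⟩
  have hδ : IsEigenSeq α q x fun n => ψ n - ψ a / φ a * φ n := fun n => by
    linear_combination hψ n - ψ a / φ a * hφ n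
  refine hδ.eq_zero_of_eq_zero (a := a) (by field_simp; ring) ?_ n
  have h := hφ.wronskian_eq_zero hψ hφ0 hψ0 a
  field_simp
  linear_combination h

theorem isSimpleEigenvalue_opB (hα : α ≠ 0) (hx : x ∈ pointSpectrum (opB α q)) :
    IsSimpleEigenvalue (opB α q) x := by
  obtain ⟨φ, hφ, hφ0⟩ := (mem_pointSpectrum_opB_iff hα).mp hx
  obtain ⟨a, ha⟩ : ∃ a, φ a ≠ 0 := by
    by_contra! h
    exact hφ0 (lp.ext (funext h))
  refine (finrank_eq_one_iff_of_nonzero'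
    (⟨φ, (mem_opEigenspace_opB_iff hα φ).mpr hφ⟩ : opEigenspace (opB α q) x)
    (fun h => hφ0 (congrArg Subtype.val h))).mpr ?_
  rintro ⟨ψ, hψ⟩
  obtain ⟨c, hc⟩ := hφ.exists_eq_mul ((mem_opEigenspace_opB_iff hα ψ).mp hψ)
    φ.tendsto_atBot ψ.tendsto_atBot ha
  exact ⟨c, Subtype.ext (lp.ext (funext fun n => (hc n).symm))⟩

end Simple

/-! ### The resolvent set -/

/-- The free operator minus w + w⁻¹ factors as -w⁻¹(1 - wS⁻¹)(1 - wS) with S an isometric shift, and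
each bracket is bounded below by 1 - |w|. -/
theorem norm_le_norm_freeJacobi {w : ℂ} (hw0 : w ≠ 0) (hw1 : ‖w‖ < 1) (φ : EllTwo) :
    (1 - ‖w‖) ^ 2 / ‖w‖ * ‖φ‖ ≤ ‖ellShift (-1) φ + ellShift 1 φ - (w + w⁻¹) • φ‖ := by
  have hb : ∀ (k : ℤ) (φ : EllTwo), (1 - ‖w‖) * ‖φ‖ ≤ ‖φ - w • ellShift k φ‖ := by
    intro k φ
    have h := norm_sub_norm_le φ (w • ellShift k φ)
    rw [norm_smul, norm_ellShift] at h
    linarith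
  have hfac : w • (ellShift (-1) φ + ellShift 1 φ - (w + w⁻¹) • φ)
      = -((φ - w • ellShift 1 φ) - w • ellShift (-1) (φ - w • ellShift 1 φ)) := by
    ext n
    show w * (φ (n + -1) + φ (n + 1) - (w + w⁻¹) * φ n)
      = -((φ n - w * φ (n + 1)) - w * (φ (n + -1) - w * φ (n + -1 + 1)))
    rw [neg_add_cancel_right]
    field_simp
    ring
  have hn := congrArg norm hfac
  rw [norm_smul, norm_neg] at hn
  have h1 := hb 1 φ
  have h2 := hb (-1) (φ - w • ellShift 1 φ)
  have hwpos : 0 < ‖w‖ := norm_pos_iff.mpr hw0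
  rw [div_mul_eq_mul_div, div_le_iff₀ hwpos, mul_comm ‖_ - _‖, hn, sq, mul_assoc]
  exact (mul_le_mul_of_nonneg_left h1 (by linarith)).trans h2

section Estimates

variable {α q : ℝ}

theorem norm_mul_zpow (hq0 : 0 < q) (n : ℤ) : ‖(α : ℂ) * (q : ℂ) ^ (-n)‖ = |α| * q ^ (-n) := by
  rw [norm_mul, norm_zpow, Complex.norm_real, Complex.norm_real, Real.norm_of_nonneg hq0.le,
    Real.norm_eq_abs]

/-- Choose `a` so that the potential on n ≤ a is at most half the free lower bound c; half of c
survives, whence 2/c. Truncation leaves errors only at a and a + 1. -/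
theorem exists_left_estimate (hq0 : 0 < q) (hq1 : q < 1) {w : ℂ} (hw0 : w ≠ 0)
    (hw1 : ‖w‖ < 1) :
    ∃ (C : ℝ) (a : ℤ), 0 ≤ C ∧ ∀ (ψ : (opB α q).domain) (φ : EllTwo),
      (∀ n, φ n = if n ≤ a then (ψ : EllTwo) n else 0) →
      ‖φ‖ ≤ C * (‖opB α q ψ - (w + w⁻¹) • (ψ : EllTwo)‖
        + ‖(ψ : EllTwo) a‖ + ‖(ψ : EllTwo) (a + 1)‖) := by
  set c := (1 - ‖w‖) ^ 2 / ‖w‖ with hc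
  have hcpos : 0 < c := div_pos (pow_pos (by linarith) 2) (norm_pos_iff.mpr hw0)
  have hlim : Tendsto (fun n : ℤ => |α| * q ^ (-n)) atBot (𝓝 0) := by
    simpa using (tendsto_zpow_neg_atBot hq0 hq1).const_mul |α|
  obtain ⟨a, ha⟩ := eventually_atBot.mp (hlim.eventually (ge_mem_nhds (half_pos hcpos)))
  refine ⟨2 / c, a, by positivity, fun ψ φ hφ => ?_⟩
  set η := opB α q ψ - (w + w⁻¹) • (ψ : EllTwo) with hη
  obtain ⟨ζ, hζ⟩ := EllTwo.exists_of_forall_norm_le (fun n => if n ≤ a then η n else 0) η (C := 1)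
    fun n => by split_ifs <;> simp
  have hPle : ∀ n, ‖(α : ℂ) * (q : ℂ) ^ (-n) * φ n‖ ≤ c / 2 * ‖φ n‖ := by
    intro n
    rw [norm_mul, norm_mul_zpow hq0, hφ]
    split_ifs with hn
    · exact mul_le_mul_of_nonneg_right (ha n hn) (norm_nonneg _)
    · simp
  obtain ⟨P, hP⟩ := EllTwo.exists_of_forall_norm_le _ φ hPle
  have hPn : ‖P‖ ≤ c / 2 * ‖φ‖ :=
    EllTwo.norm_le_mul_of_forall (by positivity) fun n => by rw [hP]; exact hPle n
  have hζn : ‖ζ‖ ≤ 1 * ‖η‖ := EllTwo.norm_le_mul_of_forall zero_le_one fun n => by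
    rw [hζ]; split_ifs <;> simp
  have heq : ellShift (-1) φ + ellShift 1 φ - (w + w⁻¹) • φ
      = ζ - P - lp.single 2 a ((ψ : EllTwo) (a + 1))
        + lp.single 2 (a + 1) ((ψ : EllTwo) a) := by
    ext n
    show φ (n + -1) + φ (n + 1) - (w + w⁻¹) * φ n = ζ n - P n
      - Pi.single (M := fun _ => ℂ) a ((ψ : EllTwo) (a + 1)) n
      + Pi.single (M := fun _ => ℂ) (a + 1) ((ψ : EllTwo) a) n
    rw [hζ, hP, hφ, hφ, hφ, Pi.single_apply, Pi.single_apply, hη, opB_sub_smul_apply,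
      ← sub_eq_add_neg]
    rcases lt_trichotomy n a with h | h | h
    · rw [if_pos (by omega), if_pos (by omega), if_pos (by omega), if_pos (by omega),
        if_neg (by omega), if_neg (by omega)]
      ring
    · subst h
      rw [if_pos (by omega), if_neg (by omega), if_pos (by omega), if_pos (by omega),
        if_pos (by omega), if_neg (by omega)]
      ring
    · rw [if_neg (by omega : ¬ n + 1 ≤ a), if_neg (by omega : ¬ n ≤ a), if_neg (by omega : ¬ n ≤ a),
        if_neg (by omega : ¬ n = a)]
      by_cases h' : n = a + 1
      · subst h'
        simp
      · rw [if_neg (by omega), if_neg h']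
        simp
  have h1 := norm_le_norm_freeJacobi hw0 hw1 φ
  rw [heq, ← hc] at h1
  have h2 := norm_add_le (ζ - P - lp.single 2 a ((ψ : EllTwo) (a + 1)))
    (lp.single 2 (a + 1) ((ψ : EllTwo) a))
  have h3 := norm_sub_le (ζ - P) (lp.single 2 a ((ψ : EllTwo) (a + 1)))
  have h4 := norm_sub_le ζ P
  rw [lp.norm_single (by norm_num)] at h2 h3
  rw [div_mul_eq_mul_div, le_div_iff₀ hcpos]
  linarith

theorem exists_right_estimate (hq0 : 0 < q) (hq1 : q < 1) (hα : α ≠ 0) (x : ℂ) :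
    ∃ b₀ : ℤ, ∀ b ≥ b₀, ∀ (ψ : (opB α q).domain) (φ : EllTwo),
      (∀ n, φ n = if b ≤ n then (ψ : EllTwo) n else 0) →
      ‖φ‖ ≤ ‖opB α q ψ - x • (ψ : EllTwo)‖ + ‖(ψ : EllTwo) (b - 1)‖ := by
  have hlim := (tendsto_zpow_neg_atTop hq0 hq1).const_mul_atTop (abs_pos.mpr hα)
  -- The margin 4 gives 4‖φ‖ ≤ ‖η‖ + 2‖φ‖ + ‖ψ_{b-1}‖, so the two shift terms are absorbed.
  obtain ⟨b₀, hb₀⟩ := eventually_atTop.mp (hlim.eventually_ge_atTop (‖x‖ + 4))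
  refine ⟨b₀, fun b hb ψ φ hφ => ?_⟩
  set η := opB α q ψ - x • (ψ : EllTwo) with hη
  set θ : EllTwo := η - ellShift (-1) φ - ellShift 1 φ - lp.single 2 b ((ψ : EllTwo) (b - 1))
    with hθ
  have hle : ∀ n, ‖φ n‖ ≤ 1 / 4 * ‖θ n‖ := by
    intro n
    by_cases hn : b ≤ n
    · have e : ((α : ℂ) * (q : ℂ) ^ (-n) - x) * φ n = θ n := by
        show _ = η n - φ (n + -1) - φ (n + 1)
          - Pi.single (M := fun _ => ℂ) b ((ψ : EllTwo) (b - 1)) n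
        rw [hφ, hφ, hφ, hη, opB_sub_smul_apply, Pi.single_apply, if_pos hn, ← sub_eq_add_neg,
          if_pos (by omega : b ≤ n + 1)]
        by_cases h' : n = b
        · subst h'
          rw [if_neg (by omega), if_pos rfl]
          ring
        · rw [if_pos (by omega), if_neg h']
          ring
      have h1 := norm_sub_norm_le ((α : ℂ) * (q : ℂ) ^ (-n)) x
      rw [norm_mul_zpow hq0] at h1
      have h2 := hb₀ n (by omega)
      rw [← e, norm_mul]
      have h3 : 4 * ‖φ n‖ ≤ ‖(α : ℂ) * (q : ℂ) ^ (-n) - x‖ * ‖φ n‖ :=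
        mul_le_mul_of_nonneg_right (by linarith) (norm_nonneg _)
      linarith
    · rw [hφ, if_neg hn, norm_zero]
      positivity
  have h1 := EllTwo.norm_le_mul_of_forall (by norm_num) hle
  have h2 := norm_sub_le (η - ellShift (-1) φ - ellShift 1 φ)
    (lp.single 2 b ((ψ : EllTwo) (b - 1)))
  have h3 := norm_sub_le (η - ellShift (-1) φ) (ellShift 1 φ)
  have h4 := norm_sub_le η (ellShift (-1) φ)
  rw [lp.norm_single (by norm_num), ← hθ] at h2
  rw [norm_ellShift] at h3 h4
  have := norm_nonneg η
  have := norm_nonneg ((ψ : EllTwo) (b - 1))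
  linarith

/-- Away from `[-2, 2]`, the operator `B - x` controls all but finitely many coordinates. -/
theorem exists_norm_le_add_sum (hq0 : 0 < q) (hq1 : q < 1) (hα : α ≠ 0) {w : ℂ} (hw0 : w ≠ 0)
    (hw1 : ‖w‖ < 1) :
    ∃ (C : ℝ) (s : Finset ℤ), ∀ ψ : (opB α q).domain,
      ‖(ψ : EllTwo)‖ ≤ C * (‖opB α q ψ - (w + w⁻¹) • (ψ : EllTwo)‖
        + ∑ n ∈ s, ‖(ψ : EllTwo) n‖) := by
  obtain ⟨C, a, hC, hleft⟩ := exists_left_estimate (α := α) hq0 hq1 hw0 hw1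
  obtain ⟨b₀, hright⟩ := exists_right_estimate hq0 hq1 hα (w + w⁻¹)
  -- This keeps the half-lines disjoint and puts the boundary sites a, a + 1 and b - 1 inside [a,
  -- b].
  set b := max b₀ (a + 2)
  have hb1 : b₀ ≤ b := le_max_left _ _
  have hb2 : a + 2 ≤ b := le_max_right _ _
  refine ⟨2 * C + 2, Finset.Icc a b, fun ψ => ?_⟩
  obtain ⟨φ, hφ⟩ := EllTwo.exists_of_forall_norm_le
    (fun n => if n ≤ a then (ψ : EllTwo) n else 0) (ψ : EllTwo) (C := 1)
    fun n => by split_ifs <;> simp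
  obtain ⟨χ, hχ⟩ := EllTwo.exists_of_forall_norm_le
    (fun n => if b ≤ n then (ψ : EllTwo) n else 0) (ψ : EllTwo) (C := 1)
    fun n => by split_ifs <;> simp
  have h1 := hleft ψ φ hφ
  have h2 := hright b hb1 ψ χ hχ
  have heq : (ψ : EllTwo) = φ + χ + ∑ n ∈ Finset.Ioo a b, lp.single 2 n ((ψ : EllTwo) n) := by
    ext n
    rw [lp.coeFn_add, lp.coeFn_add, lp.coeFn_sum, Pi.add_apply, Pi.add_apply, Finset.sum_apply,
      hφ, hχ]
    simp only [lp.single_apply, Finset.sum_pi_single, Finset.mem_Ioo]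
    split_ifs <;> first | omega | simp
  have h3 : ‖∑ n ∈ Finset.Ioo a b, lp.single 2 n ((ψ : EllTwo) n)‖
      ≤ ∑ n ∈ Finset.Icc a b, ‖(ψ : EllTwo) n‖ := by
    refine (norm_sum_le _ _).trans ?_
    refine (Finset.sum_congr rfl fun n _ => lp.norm_single (by norm_num) _ _).le.trans ?_
    exact Finset.sum_le_sum_of_subset_of_nonneg Finset.Ioo_subset_Icc_self
      fun _ _ _ => norm_nonneg _
  have hmem : ∀ n ∈ Finset.Icc a b, ‖(ψ : EllTwo) n‖ ≤ ∑ n ∈ Finset.Icc a b, ‖(ψ : EllTwo) n‖ :=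
    fun n hn => Finset.single_le_sum (f := fun n => ‖(ψ : EllTwo) n‖)
      (fun _ _ => norm_nonneg _) hn
  have m1 := hmem a (by rw [Finset.mem_Icc]; omega)
  have m2 := hmem (a + 1) (by rw [Finset.mem_Icc]; omega)
  have m3 := hmem (b - 1) (by rw [Finset.mem_Icc]; omega)
  have h4 := norm_add_le (φ + χ) (∑ n ∈ Finset.Ioo a b, lp.single 2 n ((ψ : EllTwo) n))
  rw [← heq] at h4
  have h5 := norm_add_le φ χ
  set S := ∑ n ∈ Finset.Icc a b, ‖(ψ : EllTwo) n‖
  set e := ‖opB α q ψ - (w + w⁻¹) • (ψ : EllTwo)‖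
  have he : 0 ≤ e := norm_nonneg _
  have hS : 0 ≤ S := (norm_nonneg _).trans m1
  have h6 : ‖φ‖ ≤ C * (2 * (e + S)) := h1.trans (mul_le_mul_of_nonneg_left (by linarith) hC)
  linarith

/-- Closedness of B: norm limits are coordinatewise limits, and each coordinate of B - x involves
only three sites. -/
theorem exists_mem_domain_of_tendsto (hα : α ≠ 0) {x : ℂ} {f : ℕ → (opB α q).domain}
    {ψ η : EllTwo} (hf : Tendsto (fun k => (f k : EllTwo)) atTop (𝓝 ψ))
    (hη : Tendsto (fun k => opB α q (f k) - x • (f k : EllTwo)) atTop (𝓝 η)) :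
    ∃ hd : ψ ∈ (opB α q).domain, opB α q ⟨ψ, hd⟩ - x • ψ = η := by
  refine exists_mem_domain_of_forall hα fun n => tendsto_nhds_unique ?_ (EllTwo.tendsto_apply hη n)
  have h := EllTwo.tendsto_apply hf
  exact (((h (n - 1)).add ((h n).const_mul _)).add (h (n + 1))).sub ((h n).const_mul x)

/-- Otherwise unit vectors ψₖ have (B - x)ψₖ → 0. A subsequence converges in the finitely many
uncontrolled coordinates, hence is Cauchy in ℓ², and its limit is a unit eigenvector. -/
theorem exists_norm_le_mul (hq0 : 0 < q) (hq1 : q < 1) (hα : α ≠ 0) {w : ℂ} (hw0 : w ≠ 0)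
    (hw1 : ‖w‖ < 1) (hx : w + w⁻¹ ∉ pointSpectrum (opB α q)) :
    ∃ C : ℝ, ∀ ψ : (opB α q).domain,
      ‖(ψ : EllTwo)‖ ≤ C * ‖opB α q ψ - (w + w⁻¹) • (ψ : EllTwo)‖ := by
  obtain ⟨C, s, hCs⟩ := exists_norm_le_add_sum hq0 hq1 hα hw0 hw1
  set x := w + w⁻¹
  by_contra! hcon
  have hunit : ∀ k : ℕ, ∃ ψ : (opB α q).domain, ‖(ψ : EllTwo)‖ = 1 ∧
      ‖opB α q ψ - x • (ψ : EllTwo)‖ ≤ 1 / ((k : ℝ) + 1) := by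
    intro k
    obtain ⟨ψ, hψ⟩ := hcon (k + 1)
    have hpos : 0 < ‖(ψ : EllTwo)‖ := lt_of_le_of_lt (by positivity) hψ
    have hn : ‖((‖(ψ : EllTwo)‖⁻¹ : ℝ) : ℂ)‖ = ‖(ψ : EllTwo)‖⁻¹ := by
      rw [Complex.norm_real, Real.norm_of_nonneg (by positivity)]
    refine ⟨((‖(ψ : EllTwo)‖⁻¹ : ℝ) : ℂ) • ψ, ?_, ?_⟩
    · rw [Submodule.coe_smul, norm_smul, hn, inv_mul_cancel₀ hpos.ne']
    · rw [LinearPMap.map_smul, Submodule.coe_smul, smul_comm x, ← smul_sub, norm_smul, hn,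
        inv_mul_le_iff₀ hpos, mul_one_div, le_div_iff₀ (by positivity)]
      linarith
  choose f hf1 hf2 using hunit
  obtain ⟨v, -, g, hg, hv⟩ := tendsto_subseq_of_bounded
    (Metric.isBounded_closedBall (x := (0 : s → ℂ)) (r := 1))
    (x := fun k (n : s) => (f k : EllTwo) n) fun k => by
      rw [mem_closedBall_zero_iff, pi_norm_le_iff_of_nonneg zero_le_one]
      exact fun n => (EllTwo.norm_apply_le _ _).trans (hf1 k).le
  have hη0 : Tendsto (fun k => opB α q (f k) - x • (f k : EllTwo)) atTop (𝓝 0) :=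
    squeeze_zero_norm hf2 tendsto_one_div_add_atTop_nhds_zero_nat
  have hη : Tendsto (fun k => opB α q (f (g k)) - x • (f (g k) : EllTwo)) atTop (𝓝 0) :=
    hη0.comp hg.tendsto_atTop
  have hcauchy : CauchySeq fun k => (f (g k) : EllTwo) := by
    rw [cauchySeq_iff_tendsto_dist_atTop_0]
    have hη2 : Tendsto (fun p : ℕ × ℕ => ‖(opB α q (f (g p.1)) - x • (f (g p.1) : EllTwo))
        - (opB α q (f (g p.2)) - x • (f (g p.2) : EllTwo))‖) atTop (𝓝 0) := by
      rw [← prod_atTop_atTop_eq]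
      simpa using ((hη.comp tendsto_fst).sub (hη.comp tendsto_snd)).norm
    have hs2 : Tendsto (fun p : ℕ × ℕ => ∑ n ∈ s, ‖(f (g p.1) : EllTwo) n - (f (g p.2) : EllTwo) n‖)
        atTop (𝓝 0) := by
      rw [← prod_atTop_atTop_eq]
      rw [show (0 : ℝ) = ∑ n ∈ s, 0 by simp]
      refine tendsto_finsetSum s fun n hn => ?_
      have h := (tendsto_pi_nhds.mp hv) ⟨n, hn⟩
      simpa using ((h.comp tendsto_fst).sub (h.comp tendsto_snd)).norm
    refine squeeze_zero (fun _ => dist_nonneg) (fun p => ?_)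
      (by simpa using (hη2.add hs2).const_mul C)
    have h := hCs (f (g p.1) - f (g p.2))
    rw [LinearPMap.map_sub, Submodule.coe_sub, smul_sub, sub_sub_sub_comm] at h
    rw [dist_eq_norm]
    exact h
  obtain ⟨ψ, hψ⟩ := cauchySeq_tendsto_of_complete hcauchy
  obtain ⟨hd, hker⟩ := exists_mem_domain_of_tendsto hα hψ hη
  have hψ1 : ‖ψ‖ = 1 := tendsto_nhds_unique hψ.norm (by simp [hf1])
  have hmem : ψ ∈ opEigenspace (opB α q) x :=
    (mem_opEigenspace_iff _ _ _).mpr ⟨hd, sub_eq_zero.mp hker⟩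
  rw [not_not.mp hx, Submodule.mem_bot] at hmem
  rw [hmem, norm_zero] at hψ1
  exact zero_ne_one hψ1

/-- The operator `B - x` as a linear map on the domain of `B`. -/
noncomputable def opBSub (α q : ℝ) (x : ℂ) : (opB α q).domain →ₗ[ℂ] EllTwo :=
  (opB α q).toFun - x • (opB α q).domain.subtype

theorem opBSub_apply (x : ℂ) (ψ : (opB α q).domain) :
    opBSub α q x ψ = opB α q ψ - x • (ψ : EllTwo) := rfl

/-- Testing φ against (B - x)eₙ shows that φ solves the recurrence with conjugate parameter. The
coefficients of B are real, so conjugating φ gives an eigenvector for x itself. -/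
theorem orthogonal_range_opBSub (hα : α ≠ 0) {x : ℂ} (hx : x ∉ pointSpectrum (opB α q)) :
    (LinearMap.range (opBSub α q x))ᗮ = ⊥ := by
  rw [Submodule.eq_bot_iff]
  intro φ hφ
  have hrec : ∀ n, φ (n - 1) + (α : ℂ) * (q : ℂ) ^ (-n) * φ n + φ (n + 1)
      - (starRingEnd ℂ) x * φ n = 0 := by
    intro n
    obtain ⟨hd, h⟩ := exists_mem_domain_of_forall (q := q) (x := x) hα
      (ψ := lp.single 2 n 1) (η := lp.single 2 (n + 1) 1
        + lp.single 2 n ((α : ℂ) * (q : ℂ) ^ (-n) - x) + lp.single 2 (n - 1) 1) fun j => by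
        rw [lp.coeFn_add, lp.coeFn_add, Pi.add_apply, Pi.add_apply]
        simp only [lp.single_apply, Pi.single_apply]
        simp only [sub_eq_iff_eq_add, ← eq_sub_iff_add_eq]
        by_cases h : j = n
        · subst h; simp; ring
        · simp [h]
    have h0 := (Submodule.mem_orthogonal _ _).mp hφ _ ⟨⟨_, hd⟩, h⟩
    rw [inner_add_left, inner_add_left, lp.inner_single_left, lp.inner_single_left,
      lp.inner_single_left] at h0
    simp only [RCLike.inner_apply, map_one, mul_one, map_sub, map_mul, map_zpow₀,
      Complex.conj_ofReal] at h0
    linear_combination h0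
  by_contra hne
  refine hx ((mem_pointSpectrum_opB_iff hα).mpr ⟨star φ, fun n => ?_, star_ne_zero.mpr hne⟩)
  have h := congrArg (starRingEnd ℂ) (hrec n)
  simp only [map_add, map_sub, map_mul, map_zpow₀, Complex.conj_ofReal, Complex.conj_conj,
    map_zero] at h
  simp only [lp.star_apply, RCLike.star_def]
  linear_combination h

theorem inResolventSet_of_notMem (hq0 : 0 < q) (hq1 : q < 1) (hα : α ≠ 0) {w : ℂ} (hw0 : w ≠ 0)
    (hw1 : ‖w‖ < 1) (hx : w + w⁻¹ ∉ pointSpectrum (opB α q)) :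
    InResolventSet (opB α q) (w + w⁻¹) := by
  obtain ⟨C, hC⟩ := exists_norm_le_mul hq0 hq1 hα hw0 hw1 hx
  set x := w + w⁻¹
  have hinj : Function.Injective (opBSub α q x) := by
    rw [← LinearMap.ker_eq_bot, LinearMap.ker_eq_bot']
    intro ψ hψ
    have h := hC ψ
    rw [← opBSub_apply, hψ, norm_zero, mul_zero] at h
    exact Subtype.ext (norm_le_zero_iff.mp h)
  have hclosed : IsClosed (LinearMap.range (opBSub α q x) : Set EllTwo) := by
    refine IsSeqClosed.isClosed fun u η hu hη => ?_
    choose f hf using hu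
    have hcauchy : CauchySeq fun k => (f k : EllTwo) := by
      rw [cauchySeq_iff_tendsto_dist_atTop_0]
      have hd := (cauchySeq_iff_tendsto_dist_atTop_0.mp hη.cauchySeq).const_mul C
      rw [mul_zero] at hd
      refine squeeze_zero (fun _ => dist_nonneg) (fun p => ?_) hd
      have h := hC (f p.1 - f p.2)
      rw [← opBSub_apply, map_sub, hf, hf] at h
      rw [dist_eq_norm, dist_eq_norm]
      exact h
    obtain ⟨ψ, hψ⟩ := cauchySeq_tendsto_of_complete hcauchy
    obtain ⟨hd, h⟩ := exists_mem_domain_of_tendsto (x := x) hα hψ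
      (by simpa only [← opBSub_apply, hf] using hη)
    exact ⟨⟨ψ, hd⟩, h⟩
  have hsurj : Function.Surjective (opBSub α q x) := by
    rw [← LinearMap.range_eq_top, ← hclosed.submodule_topologicalClosure_eq,
      Submodule.topologicalClosure_eq_top_iff]
    exact orthogonal_range_opBSub hα hx
  let e := LinearEquiv.ofBijective (opBSub α q x) ⟨hinj, hsurj⟩
  have he : ∀ φ, opBSub α q x (e.symm φ) = φ := fun φ => e.apply_symm_apply φ
  let R : EllTwo →L[ℂ] EllTwo :=
    ((opB α q).domain.subtype ∘ₗ e.symm.toLinearMap).mkContinuous C fun φ => by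
      have h := hC (e.symm φ)
      rw [← opBSub_apply, he] at h
      exact h
  refine ⟨R, fun φ => ⟨(e.symm φ).2, he φ⟩, fun ψ => ?_⟩
  exact congrArg Subtype.val (e.symm_apply_apply ψ)

end Estimates

/-! ### The spectrum -/

theorem exists_eq_add_inv (x : ℂ) : ∃ w : ℂ, w ≠ 0 ∧ ‖w‖ ≤ 1 ∧ x = w + w⁻¹ := by
  obtain ⟨s, hs⟩ := IsAlgClosed.exists_pow_nat_eq (x ^ 2 - 4) two_pos
  have hprod : (x + s) / 2 * ((x - s) / 2) = 1 := by linear_combination -hs / 4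
  have h1 : (x - s) / 2 = ((x + s) / 2)⁻¹ := eq_inv_of_mul_eq_one_right hprod
  have h2 : (x + s) / 2 = ((x - s) / 2)⁻¹ := eq_inv_of_mul_eq_one_left hprod
  rcases le_total ‖(x + s) / 2‖ 1 with h | h
  · exact ⟨_, left_ne_zero_of_mul_eq_one hprod, h, by rw [← h1]; ring⟩
  · refine ⟨_, right_ne_zero_of_mul_eq_one hprod, ?_, by rw [← h2]; ring⟩
    rw [h1, norm_inv]
    exact inv_le_one_of_one_le₀ h

theorem add_inv_mem_Icc_of_norm_eq_one {w : ℂ} (hw : ‖w‖ = 1) :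
    w + w⁻¹ ∈ ((↑) : ℝ → ℂ) '' Set.Icc (-2) 2 := by
  have h := (Complex.abs_re_le_norm w).trans_eq hw
  rw [abs_le] at h
  refine ⟨2 * w.re, ⟨by linarith, by linarith⟩, ?_⟩
  rw [Complex.inv_eq_conj hw, Complex.add_conj]

theorem ofReal_add_inv_notMem_Icc {r : ℝ} (hr0 : r ≠ 0) (hr1 : |r| < 1) :
    (r : ℂ) + (r : ℂ)⁻¹ ∉ ((↑) : ℝ → ℂ) '' Set.Icc (-2) 2 := by
  rintro ⟨t, ht, h⟩
  have h1 : t = r + r⁻¹ := by exact_mod_cast h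
  have h2 : t * r = r ^ 2 + 1 := by rw [h1]; field_simp
  have h3 : t * r ≤ 2 * |r| := by
    refine (le_abs_self _).trans ?_
    rw [abs_mul]
    exact mul_le_mul_of_nonneg_right (abs_le.mpr ht) (abs_nonneg r)
  have h4 : 0 < (1 - |r|) ^ 2 := pow_pos (by linarith) 2
  have h5 := sq_abs r
  nlinarith

section Main

variable {α q : ℝ}

theorem floor_logb_lt_iff (hq0 : 0 < q) (hq1 : q < 1) (hα : α ≠ 0) (m : ℤ) :
    ⌊Real.logb q |α|⌋ < m ↔ ‖(α : ℂ)⁻¹ * (q : ℂ) ^ m‖ < 1 := by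
  have hα' : 0 < |α| := abs_pos.mpr hα
  rw [Int.floor_lt, Real.logb_lt_iff_lt_rpow_of_base_lt_one hq0 hq1 hα', Real.rpow_intCast,
    norm_mul, norm_inv, norm_zpow, Complex.norm_real, Complex.norm_real,
    Real.norm_of_nonneg hq0.le, Real.norm_eq_abs, inv_mul_lt_iff₀ hα', mul_one]

theorem pointSpectrum_subset_opSpectrum {H : Type*} [NormedAddCommGroup H]
    [InnerProductSpace ℂ H] (T : H →ₗ.[ℂ] H) : pointSpectrum T ⊆ opSpectrum T := by
  rintro x hx ⟨R, -, hR⟩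
  refine hx ((Submodule.eq_bot_iff _).mpr fun ψ hψ => ?_)
  obtain ⟨hd, h⟩ := (mem_opEigenspace_iff T x ψ).mp hψ
  have := hR ⟨ψ, hd⟩
  rw [h, sub_self, map_zero] at this
  exact this.symm

theorem exists_eigenvector_opB (hq0 : 0 < q) (hq1 : q < 1) (hα : α ≠ 0) {m : ℤ}
    (hm : ⌊Real.logb q |α|⌋ < m) :
    ∃ v : EllTwo, (∀ j : ℤ, v j = eigvecB α q m j) ∧ v ≠ 0 ∧
      v ∈ opEigenspace (opB α q) (eigvalB α q m) := by
  rw [floor_logb_lt_iff hq0 hq1 hα] at hm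
  -- The eigenvector is even in ℓ¹, which embeds in ℓ².
  have hmem : Memℓp (eigvecB α q m) 1 :=
    memℓp_gen (by simpa using (summable_eigvecB hq0 hq1 hα hm).norm)
  refine ⟨⟨eigvecB α q m, hmem.of_exponent_ge one_le_two⟩, fun _ => rfl, fun h => ?_,
    (mem_opEigenspace_opB_iff hα _).mpr (isEigenSeq_eigvecB hq0 hq1 hα hm)⟩
  obtain ⟨j, hj⟩ := exists_eigvecB_ne_zero hq0 hq1 hα hm
  exact hj (congrArg (fun φ : EllTwo => φ j) h)

theorem pointSpectrum_opB (hq0 : 0 < q) (hq1 : q < 1) (hα : α ≠ 0) :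
    pointSpectrum (opB α q) = {x : ℂ | ∃ m : ℤ, ⌊Real.logb q |α|⌋ < m ∧ x = eigvalB α q m} := by
  ext x
  constructor
  · intro hx
    obtain ⟨ψ, hψ, hψ0⟩ := (mem_pointSpectrum_opB_iff hα).mp hx
    obtain ⟨w, hw0, hw1, rfl⟩ := exists_eq_add_inv x
    have hne : ∃ n, ψ n ≠ 0 := by
      by_contra! h
      exact hψ0 (lp.ext (funext h))
    obtain ⟨hw, m, hm⟩ := hψ.exists_zpow hq0 hq1 hα hw0 hw1 ψ.norm_apply_le ψ.tendsto_atBot hne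
    have hαc : (α : ℂ) ≠ 0 := by exact_mod_cast hα
    have hw' : w = (α : ℂ)⁻¹ * (q : ℂ) ^ m := by rw [← hm, inv_mul_cancel_left₀ hαc]
    refine ⟨m, ?_, by rw [eigvalB_eq, hw']⟩
    rwa [floor_logb_lt_iff hq0 hq1 hα, ← hw']
  · rintro ⟨m, hm, rfl⟩
    obtain ⟨v, -, hv0, hv⟩ := exists_eigenvector_opB hq0 hq1 hα hm
    exact (mem_pointSpectrum_opB_iff hα).mpr ⟨v, (mem_opEigenspace_opB_iff hα v).mp hv, hv0⟩

theorem opSpectrum_opB_diff_Icc (hq0 : 0 < q) (hq1 : q < 1) (hα : α ≠ 0) :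
    opSpectrum (opB α q) \ (((↑) : ℝ → ℂ) '' Set.Icc (-2) 2) = pointSpectrum (opB α q) := by
  refine Set.Subset.antisymm ?_ fun x hx => ⟨pointSpectrum_subset_opSpectrum _ hx, ?_⟩
  · rintro x ⟨hx, hI⟩
    obtain ⟨w, hw0, hw1, rfl⟩ := exists_eq_add_inv x
    have hw : ‖w‖ < 1 := lt_of_le_of_ne hw1 fun h => hI (add_inv_mem_Icc_of_norm_eq_one h)
    by_contra hp
    exact hx (inResolventSet_of_notMem hq0 hq1 hα hw0 hw hp)
  · rw [pointSpectrum_opB hq0 hq1 hα] at hx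
    obtain ⟨m, hm, rfl⟩ := hx
    rw [floor_logb_lt_iff hq0 hq1 hα] at hm
    have hcast : (α : ℂ)⁻¹ * (q : ℂ) ^ m = ((α⁻¹ * q ^ m : ℝ) : ℂ) := by push_cast; rfl
    rw [eigvalB_eq, hcast]
    rw [hcast, Complex.norm_real, Real.norm_eq_abs] at hm
    exact ofReal_add_inv_notMem_Icc
      (mul_ne_zero (inv_ne_zero hα) (zpow_ne_zero _ hq0.ne')) hm

end Main

theorem mainTheorem4 (q α : ℝ) (hq0 : 0 < q) (hq1 : q < 1) (hα : α ≠ 0) :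
    opSpectrum (opB α q) \ (((↑) : ℝ → ℂ) '' Set.Icc (-2) 2) = pointSpectrum (opB α q) ∧
    pointSpectrum (opB α q) = {x : ℂ | ∃ m : ℤ, ⌊Real.logb q |α|⌋ < m ∧ x = eigvalB α q m} ∧
    (∀ x ∈ pointSpectrum (opB α q), IsSimpleEigenvalue (opB α q) x) ∧
    (∀ m : ℤ, ⌊Real.logb q |α|⌋ < m →
      ∃ v : EllTwo, (∀ j : ℤ, v j = eigvecB α q m j) ∧ v ≠ 0 ∧
        v ∈ opEigenspace (opB α q) (eigvalB α q m)) :=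
  ⟨opSpectrum_opB_diff_Icc hq0 hq1 hα, pointSpectrum_opB hq0 hq1 hα,
    fun _ hx => isSimpleEigenvalue_opB hα hx, fun _ hm => exists_eigenvector_opB hq0 hq1 hα hm⟩
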